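/- Let $\mathcal H_A=\mathbb C^{d_A}$, $\mathcal H_B=\mathbb C^{d_B}$ with $d_A,d_B\ge 1$ and fixed orthonormal bases. Let $\mathrm D(\mathcal H)$ be the set of density matrices on $\mathcal H$, let $\mathscr C(\mathcal H_A\to\mathcal H_B)$ be the set of completely positive trace-preserving linear maps $\mathrm{End}(\mathcal H_A)\to\mathrm{End}(\mathcal H_B)$ (channels), both with their Borel $\sigma$-algebras, and let $$J(\Lambda)=(\mathrm{id}_A\otimes\Lambda)(|\hat\Phi\rangle\langle\hat\Phi|),\qquad |\hat\Phi\rangle=d_A^{-1/2}\sum_k|k\rangle|k\rangle,$$ be the Choi–Jamiołkowski bijection from channels onto the Choi states $\{\rho\in\mathrm D(\mathcal H_A\otimes\mathcal H_B):\mathrm{tr}_B\rho=\mathbb 1/d_A\}$. Let $A'B'$ be a copy of $AB$. Let $\mathrm d\sigma_{AB}$ be the law of $\mathrm{tr}_{A'B'}(U|\psi_0\rangle\langle\psi_0|U^\dagger)$, where $\psi_0\in\mathcal H_{ABA'B'}$ is an arbitrary unit vector and $U$ is a Haar-distributed unitary on $\mathcal H_{ABA'B'}$; let $\mathrm d\sigma_A$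 be the image of $\mathrm d\sigma_{AB}$ under $\mathrm{tr}_B$. Let $|\Psi_0\rangle=d_A^{-1/2}\sum_{i=1}^{d_A}|i\rangle_A|v_i\rangle_{BA'B'}$ with $(v_i)$ an arbitrary orthonormal family in $\mathcal H_{BA'B'}$, and let $\mathrm d\nu$ be the law of the channel $J^{-1}\big(\mathrm{tr}_{A'B'}[(\mathbb 1_A\otimes U)|\Psi_0\rangle\langle\Psi_0|(\mathbb 1_A\otimes U)^\dagger]\big)$, where $U$ is a Haar-distributed unitary on $\mathcal H_{BA'B'}$. Below, $y^{\pm1/2}$ for $y\in \mathrm D(\mathcal H_A)$ stands for $y^{\pm 1/2}\otimes\mathbb 1_B$. Then: 1. The set of rank-deficient $y\in\mathrm D(\mathcal H_A)$ has $\mathrm d\sigma_A$-measure zero. 2. There is a measurable family $(\nu_y)$ of probability measures on $\mathrm D(\mathcal H_{AB})$, indexed by the full-rank $y\in\mathrm D(\mathcal H_A)$, such that $$\int \mathrm d\sigma_{AB}\,g(\sigma_{AB})=\int\mathrm d\sigma_A(y)\int_{\mathrm{tr}_B^{-1}(y)}\mathrm d\nu_y(\sigma_{AB})\,g(\sigma_{AB})$$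 for all measurable $g\ge0$ and all integrable $g:\mathrm D(\mathcal H_{AB})\to\mathbb C$. The family is essentially unique: any measurable family of probability measures satisfying this identity for all measurable $g\ge 0$ coincides with $(\nu_y)$ for $\mathrm d\sigma_A$-almost every $y$. Moreover, for every full-rank $y$, $\nu_y$ is concentrated on the fibre $\mathrm{tr}_B^{-1}(y)$, and $$J_y^{-1}:\mathrm{tr}_B^{-1}(y)\to\mathscr C(\mathcal H_A\to\mathcal H_B),\qquad \sigma\mapsto J^{-1}\big(d_A^{-1}y^{-1/2}\sigma y^{-1/2}\big)$$ is a Borel isomorphism, with inverse $\Lambda\mapsto d_A\,y^{1/2}J(\Lambda)y^{1/2}$, carrying $\nu_y$ to $\nu$. 3. For all measurable $g\ge 0$ on $\mathrm D(\mathcal H_{AB})$, and for all integrable $g:\mathrm D(\mathcal H_{AB})\to\mathbb C$ (the iterated integrals then being well defined almost everywhere and integrable), $$\int\mathrm d\sigma_{AB}\,g(\sigma_{AB})=\int\mathrm d\sigma_A\int\mathrm d\nu(\Lambda)\,g\big(d_A\sigma_A^{1/2}J(\Lambda)\sigma_A^{1/2}\big)=\int\mathrm d\sigma_A\int\mathrm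 d\nu(\Lambda)\,g\big(d_A\sigma_P^{1/2}J(\Lambda)\sigma_P^{1/2}\big),\qquad \sigma_P=\sigma_A^{\intercal}.$$ -/

import Mathlib

open MeasureTheory ProbabilityTheory Matrix
open scoped ComplexOrder MatrixOrder Kronecker ENNReal

set_option linter.unusedSectionVars false

noncomputable section

namespace ChannelMeasures

/-! ### Borel structure on complex matrices, Haar measure on the unitary group -/

section Haar

variable {m n : Type*} [Fintype m] [Fintype n]

instance instMeasurableSpaceMatrix : MeasurableSpace (Matrix m n ℂ) :=
  inferInstanceAs (MeasurableSpace (m → n → ℂ))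

instance instBorelSpaceMatrix : BorelSpace (Matrix m n ℂ) :=
  inferInstanceAs (BorelSpace (m → n → ℂ))

variable [DecidableEq n]

theorem isCompact_unitaryGroup : IsCompact (unitaryGroup n ℂ : Set (Matrix n n ℂ)) := by
  have hcl : IsClosed (unitaryGroup n ℂ : Set (Matrix n n ℂ)) := by
    have : (unitaryGroup n ℂ : Set (Matrix n n ℂ)) = {U | U * star U = 1} := by
      ext U; exact mem_unitaryGroup_iff
    rw [this]
    exact isClosed_eq (by fun_prop) continuous_const
  have hK : IsCompact {M : Matrix n n ℂ | ∀ i, M i ∈ {r : n → ℂ | ∀ j, r j ∈ Metric.closedBall (0 : ℂ) 1}} :=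
    isCompact_pi_infinite fun _ => isCompact_pi_infinite fun _ => isCompact_closedBall 0 1
  refine hK.of_isClosed_subset hcl fun U hU i j => ?_
  simpa using entry_norm_bound_of_unitary hU i j

instance instCompactSpaceUnitaryGroup : CompactSpace (unitaryGroup n ℂ) :=
  isCompact_iff_compactSpace.mp isCompact_unitaryGroup

/-- The normalized Haar measure on the group of unitary `n × n` matrices. -/
def haarUnitary (n : Type*) [Fintype n] [DecidableEq n] : Measure (unitaryGroup n ℂ) :=
  Measure.haarMeasure ⊤

end Haar

/-! ### Density matrices -/

/-- Density matrices on `ℂⁿ`: positive semidefinite matrices of trace one. -/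
abbrev State (n : Type*) [Fintype n] : Type _ :=
  {ρ : Matrix n n ℂ // ρ.PosSemidef ∧ ρ.trace = 1}

section State

variable {m n : Type*} [Fintype m] [Fintype n]

/-- The partial trace over the second tensor factor. -/
def ptrRight (M : Matrix (m × n) (m × n) ℂ) : Matrix m m ℂ :=
  of fun i j => ∑ k, M (i, k) (j, k)

/-- The partial trace over the first tensor factor. -/
def ptrLeft (M : Matrix (m × n) (m × n) ℂ) : Matrix n n ℂ :=
  of fun x y => ∑ i, M (i, x) (i, y)

theorem ptrRight_posSemidef {M : Matrix (m × n) (m × n) ℂ} (hM : M.PosSemidef) :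
    (ptrRight M).PosSemidef := by
  have : ptrRight M = ∑ k, M.submatrix (fun i => (i, k)) (fun i => (i, k)) := by
    ext i j; simp [ptrRight, Matrix.sum_apply]
  rw [this]
  exact posSemidef_sum _ fun k _ => hM.submatrix _

theorem trace_ptrRight (M : Matrix (m × n) (m × n) ℂ) : (ptrRight M).trace = M.trace := by
  simp [Matrix.trace, ptrRight, Fintype.sum_prod_type]

/-- The marginal of a bipartite state on the first system. -/
def State.marginal (ρ : State (m × n)) : State m :=
  ⟨ptrRight ρ.1, ptrRight_posSemidef ρ.2.1, (trace_ptrRight _).trans ρ.2.2⟩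

/-- Relabelling of the basis of a system. -/
def State.reindex (e : m ≃ n) (ρ : State m) : State n :=
  ⟨ρ.1.submatrix e.symm e.symm, ρ.2.1.submatrix _, by
    exact (Equiv.sum_comp e.symm fun i => ρ.1 i i).trans ρ.2.2⟩

/-- The transposed state (in the fixed basis). -/
def State.transpose (ρ : State n) : State n :=
  ⟨ρ.1ᵀ, ρ.2.1.transpose, by rw [trace_transpose, ρ.2.2]⟩

/-- The pure state `|ψ⟩⟨ψ|` of a unit vector `ψ`. -/
def pureState (ψ : EuclideanSpace ℂ n) (hψ : ‖ψ‖ = 1) : State n :=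
  ⟨vecMulVec ψ.ofLp (star ψ.ofLp), posSemidef_vecMulVec_self_star _, by
    rw [trace_vecMulVec, dotProduct_comm]
    have h := EuclideanSpace.inner_eq_star_dotProduct ψ ψ
    rw [dotProduct_comm, ← h, inner_self_eq_norm_sq_to_K, hψ]; simp⟩

variable [DecidableEq n]

/-- The action `ρ ↦ U ρ U†` of a unitary on states. -/
def State.conj (U : unitaryGroup n ℂ) (ρ : State n) : State n :=
  ⟨U.1 * ρ.1 * star U.1, ρ.2.1.mul_mul_conjTranspose_same _, by
    rw [trace_mul_comm, ← mul_assoc, mem_unitaryGroup_iff'.mp U.2, one_mul, ρ.2.2]⟩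

/-- A state has full rank. -/
def State.FullRank (ρ : State n) : Prop := ρ.1.rank = Fintype.card n

/-- The square root of a density matrix. -/
def State.sqrt (ρ : State n) : Matrix n n ℂ := CFC.sqrt ρ.1

theorem State.sqrt_posSemidef (ρ : State n) : ρ.sqrt.PosSemidef :=
  nonneg_iff_posSemidef.mp (CFC.sqrt_nonneg _)

theorem State.sqrt_mul_sqrt (ρ : State n) : ρ.sqrt * ρ.sqrt = ρ.1 :=
  CFC.sqrt_mul_sqrt_self _ (nonneg_iff_posSemidef.mpr ρ.2.1)

theorem State.FullRank.isUnit_sqrt {ρ : State n} (h : ρ.FullRank) : IsUnit ρ.sqrt := by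
  have h1 : ρ.sqrt.rank = Fintype.card n := by
    refine le_antisymm (rank_le_card_width _) ?_
    have := rank_mul_le_left ρ.sqrt ρ.sqrt
    rw [ρ.sqrt_mul_sqrt] at this
    exact h.symm.le.trans this
  rw [← Matrix.mulVec_surjective_iff_isUnit]
  have h2 : LinearMap.range ρ.sqrt.mulVecLin = ⊤ :=
    Submodule.eq_top_of_finrank_eq (by rw [← Matrix.rank, h1, Module.finrank_fintype_fun_eq_card])
  exact LinearMap.range_eq_top.mp h2

end State

/-! ### Quantum channels and the Choi–Jamiołkowski isomorphism -/

section Channel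

variable {a b : Type*} [Fintype a] [Fintype b]

/-- `id_k ⊗ Λ` on matrices over `ℂᵏ ⊗ ℂᵃ`. -/
def ampliation (k : Type*) (Λ : Matrix a a ℂ →ₗ[ℂ] Matrix b b ℂ)
    (M : Matrix (k × a) (k × a) ℂ) : Matrix (k × b) (k × b) ℂ :=
  of fun p q => Λ (of fun i j => M (p.1, i) (q.1, j)) p.2 q.2

def IsCompletelyPositive (Λ : Matrix a a ℂ →ₗ[ℂ] Matrix b b ℂ) : Prop :=
  ∀ (k : ℕ) (M : Matrix (Fin k × a) (Fin k × a) ℂ),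
    M.PosSemidef → (ampliation (Fin k) Λ M).PosSemidef

def IsTracePreserving (Λ : Matrix a a ℂ →ₗ[ℂ] Matrix b b ℂ) : Prop :=
  ∀ ρ, (Λ ρ).trace = ρ.trace

/-- Quantum channels: completely positive trace-preserving linear maps. -/
abbrev Channel (a b : Type*) [Fintype a] [Fintype b] : Type _ :=
  {Λ : Matrix a a ℂ →ₗ[ℂ] Matrix b b ℂ // IsCompletelyPositive Λ ∧ IsTracePreserving Λ}

/-- The Borel σ-algebra of the space of channels: the one generated by the evaluations
`Λ ↦ Λ ρ`. -/
instance instMeasurableSpaceChannel : MeasurableSpace (Channel a b) :=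
  MeasurableSpace.comap (fun (Λ : Channel a b) (ρ : Matrix a a ℂ) => Λ.1 ρ) MeasurableSpace.pi

theorem IsCompletelyPositive.ampliation_posSemidef {Λ : Matrix a a ℂ →ₗ[ℂ] Matrix b b ℂ}
    (hΛ : IsCompletelyPositive Λ) {k : Type*} [Fintype k]
    {M : Matrix (k × a) (k × a) ℂ} (hM : M.PosSemidef) : (ampliation k Λ M).PosSemidef := by
  let e := Fintype.equivFin k
  have h := hΛ _ _ (hM.submatrix fun p : Fin (Fintype.card k) × a => (e.symm p.1, p.2))
  have h' := h.submatrix fun p : k × b => (e p.1, p.2)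
  convert h' using 1
  ext p q
  simp [ampliation]

variable [DecidableEq a]

/-- The maximally entangled vector `d⁻¹ᐟ² ∑ₖ |k⟩|k⟩`. -/
def maxEntangled (a : Type*) [Fintype a] [DecidableEq a] : a × a → ℂ :=
  fun p => if p.1 = p.2 then ((√(Fintype.card a : ℝ) : ℝ) : ℂ)⁻¹ else 0

/-- The Choi matrix `(id ⊗ Λ)(|Φ⟩⟨Φ|)` of a linear map. -/
def choiMatrix (Λ : Matrix a a ℂ →ₗ[ℂ] Matrix b b ℂ) : Matrix (a × b) (a × b) ℂ :=
  ampliation a Λ (vecMulVec (maxEntangled a) (star (maxEntangled a)))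

/-- Choi states: bipartite states whose first marginal is maximally mixed. -/
abbrev ChoiState (a b : Type*) [Fintype a] [Fintype b] [DecidableEq a] : Type _ :=
  {ρ : State (a × b) // ρ.marginal.1 = (Fintype.card a : ℂ)⁻¹ • (1 : Matrix a a ℂ)}

theorem choiMatrix_apply (Λ : Matrix a a ℂ →ₗ[ℂ] Matrix b b ℂ) (p q : a × b) :
    choiMatrix Λ p q = (Fintype.card a : ℂ)⁻¹ * Λ (single p.1 q.1 1) p.2 q.2 := by
  have h : (of fun i j => vecMulVec (maxEntangled a) (star (maxEntangled a)) (p.1, i) (q.1, j)) =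
      (Fintype.card a : ℂ)⁻¹ • (single p.1 q.1 1 : Matrix a a ℂ) := by
    ext i j
    have h2 : ((√(Fintype.card a : ℝ) : ℝ) : ℂ)⁻¹ * ((√(Fintype.card a : ℝ) : ℝ) : ℂ)⁻¹
        = (Fintype.card a : ℂ)⁻¹ := by
      rw [← mul_inv, ← Complex.ofReal_mul, Real.mul_self_sqrt (by positivity)]; simp
    by_cases hi : p.1 = i <;> by_cases hj : q.1 = j <;>
      simp [vecMulVec_apply, maxEntangled, hi, hj, h2]
  simp only [choiMatrix, ampliation, of_apply]
  rw [h, map_smul]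
  simp

variable [DecidableEq b]

/-- The inverse Choi–Jamiołkowski map `ρ ↦ d_A tr_A (C (ρᵀ ⊗ 1))`. -/
def choiInverse (C : Matrix (a × b) (a × b) ℂ) : Matrix a a ℂ →ₗ[ℂ] Matrix b b ℂ where
  toFun ρ := (Fintype.card a : ℂ) • ptrLeft (C * (ρᵀ ⊗ₖ (1 : Matrix b b ℂ)))
  map_add' ρ σ := by
    ext x y
    simp [ptrLeft, transpose_add, add_kronecker, mul_add, Finset.sum_add_distrib]
  map_smul' c ρ := by
    ext x y
    simp [ptrLeft, transpose_smul, smul_kronecker, Finset.mul_sum]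
    exact Finset.sum_congr rfl fun _ _ => by ring

theorem choiInverse_apply (C : Matrix (a × b) (a × b) ℂ) (ρ : Matrix a a ℂ) (x y : b) :
    choiInverse C ρ x y = (Fintype.card a : ℂ) * ∑ i, ∑ j, C (i, x) (j, y) * ρ i j := by
  simp [choiInverse, ptrLeft, mul_apply, Fintype.sum_prod_type, kroneckerMap_apply, one_apply]

variable [Nonempty a]

theorem choiMatrix_choiInverse (C : Matrix (a × b) (a × b) ℂ) :
    choiMatrix (choiInverse C) = C := by
  have hd : (Fintype.card a : ℂ) ≠ 0 := by simp
  ext p q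
  rw [choiMatrix_apply, choiInverse_apply, inv_mul_cancel_left₀ hd,
    Finset.sum_eq_single p.1, Finset.sum_eq_single q.1]
  · simp
  · intro j _ hj; simp [hj.symm]
  · simp
  · intro i _ hi; simp [hi.symm]
  · simp

theorem choiInverse_choiMatrix (Λ : Matrix a a ℂ →ₗ[ℂ] Matrix b b ℂ) :
    choiInverse (choiMatrix Λ) = Λ := by
  have hd : (Fintype.card a : ℂ) ≠ 0 := by simp
  refine LinearMap.ext fun ρ => ?_
  ext x y
  conv_rhs => rw [matrix_eq_sum_single ρ]
  rw [choiInverse_apply, map_sum, Matrix.sum_apply, Finset.mul_sum]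
  refine Finset.sum_congr rfl fun i _ => ?_
  rw [map_sum, Matrix.sum_apply, Finset.mul_sum]
  refine Finset.sum_congr rfl fun j _ => ?_
  have : (single i j (ρ i j) : Matrix a a ℂ) = ρ i j • single i j 1 := by simp
  rw [choiMatrix_apply, this, map_smul, Matrix.smul_apply, smul_eq_mul]
  field_simp

theorem choiInverse_isCompletelyPositive {C : Matrix (a × b) (a × b) ℂ} (hC : C.PosSemidef) :
    IsCompletelyPositive (choiInverse C) := by
  intro k M hM
  have h1 := (hC.kronecker hM).submatrix
    fun r : a × (Fin k × b) => ((r.1, r.2.2), (r.2.1, r.1))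
  let W : Matrix (a × (Fin k × b)) (Fin k × b) ℂ := of fun r p => if r.2 = p then 1 else 0
  have h2 := (h1.conjTranspose_mul_mul_same W).smul
    (show (0 : ℂ) ≤ (Fintype.card a : ℂ) by positivity)
  have hsum : ∀ (f : a × (Fin k × b) → ℂ) (q : Fin k × b),
      ∑ r, (if r.2 = q then f r else 0) = ∑ i, f (i, q) := by
    intro f q
    rw [Fintype.sum_prod_type]
    simp
  have h3 : ampliation (Fin k) (choiInverse C) M = (Fintype.card a : ℂ) • (Wᴴ *
      (C ⊗ₖ M).submatrix (fun r : a × (Fin k × b) => ((r.1, r.2.2), (r.2.1, r.1)))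
        (fun r : a × (Fin k × b) => ((r.1, r.2.2), (r.2.1, r.1))) * W) := by
    ext p q
    rw [Matrix.smul_apply, smul_eq_mul, ampliation, of_apply, choiInverse_apply, mul_apply]
    congr 1
    simp only [mul_apply, W, conjTranspose_apply, of_apply, apply_ite star, star_one, star_zero,
      ite_mul, one_mul, zero_mul, mul_ite, mul_one, mul_zero]
    rw [hsum]
    simp only [hsum]
    rw [Finset.sum_comm]
    rfl
  rw [h3]
  exact h2

theorem choiInverse_isTracePreserving {C : Matrix (a × b) (a × b) ℂ}
    (hC : ptrRight C = (Fintype.card a : ℂ)⁻¹ • (1 : Matrix a a ℂ)) :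
    IsTracePreserving (choiInverse C) := by
  have hd : (Fintype.card a : ℂ) ≠ 0 := by simp
  intro ρ
  have h : ∀ i j, ∑ x, C (i, x) (j, x) = (Fintype.card a : ℂ)⁻¹ * (1 : Matrix a a ℂ) i j := by
    intro i j
    have := congrFun (congrFun hC i) j
    simpa [ptrRight] using this
  simp only [Matrix.trace, diag_apply, choiInverse_apply]
  rw [← Finset.mul_sum, Finset.sum_comm, Finset.mul_sum]
  refine Finset.sum_congr rfl fun i _ => ?_
  rw [Finset.sum_comm]
  simp_rw [← Finset.sum_mul, h]
  simp [one_apply, hd]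

theorem ptrRight_choiMatrix {Λ : Matrix a a ℂ →ₗ[ℂ] Matrix b b ℂ} (hΛ : IsTracePreserving Λ) :
    ptrRight (choiMatrix Λ) = (Fintype.card a : ℂ)⁻¹ • (1 : Matrix a a ℂ) := by
  ext i j
  have h := hΛ (single i j 1)
  simp only [Matrix.trace, diag_apply] at h
  simp only [ptrRight, of_apply, choiMatrix_apply, ← Finset.mul_sum, Matrix.smul_apply, smul_eq_mul]
  rw [h]
  by_cases hij : i = j
  · subst hij; simp [single_apply]
  · have : ∀ x, ¬ (i = x ∧ j = x) := fun x hx => hij (hx.1.trans hx.2.symm)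
    simp [one_apply, hij, this]

/-- The Choi–Jamiołkowski isomorphism `J` between channels and Choi states. -/
def choiEquiv (a b : Type*) [Fintype a] [Fintype b] [DecidableEq a] [DecidableEq b]
    [Nonempty a] : Channel a b ≃ ChoiState a b where
  toFun Λ := ⟨⟨choiMatrix Λ.1,
      Λ.2.1.ampliation_posSemidef (posSemidef_vecMulVec_self_star _), by
        rw [← trace_ptrRight, ptrRight_choiMatrix Λ.2.2]; simp⟩,
    ptrRight_choiMatrix Λ.2.2⟩
  invFun C := ⟨choiInverse C.1.1, choiInverse_isCompletelyPositive C.1.2.1,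
    choiInverse_isTracePreserving C.2⟩
  left_inv Λ := Subtype.ext (choiInverse_choiMatrix Λ.1)
  right_inv C := Subtype.ext (Subtype.ext (choiMatrix_choiInverse C.1.1))

end Channel

/-! ### The two Haar-induced measures -/

section Measures

variable {a b n : Type*} [Fintype a] [Fintype b] [Fintype n]
  [DecidableEq a] [DecidableEq b] [DecidableEq n]

/-- The Haar-induced measure on pure states: the law of `U |ψ₀⟩⟨ψ₀| U†` for Haar-random `U`. -/
def pureMeasure (ψ₀ : EuclideanSpace ℂ n) (hψ₀ : ‖ψ₀‖ = 1) : Measure (State n) :=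
  (haarUnitary n).map fun U => (pureState ψ₀ hψ₀).conj U

/-- The measure `dσ_AB`: partial trace over `A'B' ≅ AB` of a Haar-random pure state
on `ABA'B'`. -/
def stateMeasure (ψ₀ : EuclideanSpace ℂ ((a × b) × (a × b))) (hψ₀ : ‖ψ₀‖ = 1) :
    Measure (State (a × b)) :=
  (pureMeasure ψ₀ hψ₀).map State.marginal

/-- The measure `dσ_A`: the reduced measure of `dσ_AB`. -/
def marginalMeasure (ψ₀ : EuclideanSpace ℂ ((a × b) × (a × b))) (hψ₀ : ‖ψ₀‖ = 1) :
    Measure (State a) :=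
  (stateMeasure ψ₀ hψ₀).map State.marginal

/-- The reference vector `Ψ₀ = d_A⁻¹ᐟ² ∑ᵢ |i⟩|vᵢ⟩`. -/
def referenceVector (v : a → EuclideanSpace ℂ n) : EuclideanSpace ℂ (a × n) :=
  WithLp.toLp 2 fun p => ((√(Fintype.card a : ℝ) : ℝ) : ℂ)⁻¹ * v p.1 p.2

theorem norm_referenceVector [Nonempty a] {v : a → EuclideanSpace ℂ n} (hv : Orthonormal ℂ v) :
    ‖referenceVector v‖ = 1 := by
  have h : ∀ i, ∑ k, ‖v i k‖ ^ 2 = 1 := fun i => by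
    rw [← EuclideanSpace.norm_sq_eq, hv.1 i, one_pow]
  have : ‖referenceVector v‖ ^ 2 = 1 := by
    rw [EuclideanSpace.norm_sq_eq]
    simp only [referenceVector, norm_mul, mul_pow, Fintype.sum_prod_type, ← Finset.mul_sum, h]
    simp
  exact (pow_eq_one_iff_of_nonneg (norm_nonneg _) two_ne_zero).mp this

/-- The unitary `1_A ⊗ U`. -/
def localUnitary (a : Type*) [Fintype a] [DecidableEq a] (U : unitaryGroup n ℂ) :
    unitaryGroup (a × n) ℂ :=
  ⟨(1 : Matrix a a ℂ) ⊗ₖ U.1, kronecker_mem_unitary (one_mem _) U.2⟩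

variable [Nonempty a]

/-- The purified Choi state `(1_A ⊗ U)|Ψ₀⟩⟨Ψ₀|(1_A ⊗ U)†`. -/
def purifiedChoi (v : a → EuclideanSpace ℂ n) (hv : Orthonormal ℂ v) (U : unitaryGroup n ℂ) :
    State (a × n) :=
  (pureState (referenceVector v) (norm_referenceVector hv)).conj (localUnitary a U)

theorem marginal_purifiedChoi (v : a → EuclideanSpace ℂ n) (hv : Orthonormal ℂ v)
    (U : unitaryGroup n ℂ) :
    (purifiedChoi v hv U).marginal.1 = (Fintype.card a : ℂ)⁻¹ • (1 : Matrix a a ℂ) := by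
  have h1 : (purifiedChoi v hv U).1 =
      vecMulVec (((1 : Matrix a a ℂ) ⊗ₖ U.1) *ᵥ (referenceVector v).ofLp)
        (star (((1 : Matrix a a ℂ) ⊗ₖ U.1) *ᵥ (referenceVector v).ofLp)) := by
    simp only [purifiedChoi, State.conj, pureState, localUnitary, star_eq_conjTranspose]
    rw [mul_vecMulVec, vecMulVec_mul, star_mulVec]
  have h2 : ∀ i k, (((1 : Matrix a a ℂ) ⊗ₖ U.1) *ᵥ (referenceVector v).ofLp) (i, k) =
      ((√(Fintype.card a : ℝ) : ℝ) : ℂ)⁻¹ * (U.1 *ᵥ (v i).ofLp) k := by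
    intro i k
    simp only [mulVec, dotProduct, Fintype.sum_prod_type, kroneckerMap_apply, referenceVector,
      one_apply, Finset.mul_sum]
    rw [Finset.sum_eq_single i]
    · exact Finset.sum_congr rfl fun _ _ => by simp; ring
    · intro j _ hj
      simp [hj.symm]
    · simp
  have h3 : ((√(Fintype.card a : ℝ) : ℝ) : ℂ)⁻¹ * ((√(Fintype.card a : ℝ) : ℝ) : ℂ)⁻¹
      = (Fintype.card a : ℂ)⁻¹ := by
    rw [← mul_inv, ← Complex.ofReal_mul, Real.mul_self_sqrt (by positivity)]; simp
  have h4 : ∀ i j, ∑ k, (U.1 *ᵥ (v i).ofLp) k * star ((U.1 *ᵥ (v j).ofLp) k) =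
      (1 : Matrix a a ℂ) i j := by
    intro i j
    have h5 : (U.1 *ᵥ (v i).ofLp) ⬝ᵥ star (U.1 *ᵥ (v j).ofLp) = (v i).ofLp ⬝ᵥ star (v j).ofLp := by
      rw [star_mulVec, dotProduct_comm, ← dotProduct_mulVec, mulVec_mulVec,
        ← star_eq_conjTranspose, mem_unitaryGroup_iff'.mp U.2, one_mulVec, dotProduct_comm]
    refine h5.trans ?_
    rw [← EuclideanSpace.inner_eq_star_dotProduct, orthonormal_iff_ite.mp hv j i, one_apply]
    simp only [eq_comm]
  ext i j
  simp only [State.marginal, ptrRight, of_apply, h1, vecMulVec_apply, Pi.star_apply, h2,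
    Matrix.smul_apply, smul_eq_mul, ← h4, Finset.mul_sum]
  refine Finset.sum_congr rfl fun k _ => ?_
  rw [star_mul', ← h3]
  simp
  ring

/-- The Choi state obtained from `(1_A ⊗ U)|Ψ₀⟩` by tracing out `A'B'`. -/
def randomChoi (v : a → EuclideanSpace ℂ (b × (a × b))) (hv : Orthonormal ℂ v)
    (U : unitaryGroup (b × (a × b)) ℂ) : ChoiState a b :=
  ⟨((purifiedChoi v hv U).reindex (Equiv.prodAssoc a b (a × b)).symm).marginal, by
    rw [← marginal_purifiedChoi v hv U]
    ext i j
    simp [State.marginal, State.reindex, ptrRight, Fintype.sum_prod_type]⟩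

/-- The Haar-induced measure `dν` on Choi states. -/
def choiMeasure (v : a → EuclideanSpace ℂ (b × (a × b))) (hv : Orthonormal ℂ v) :
    Measure (ChoiState a b) :=
  (haarUnitary (b × (a × b))).map (randomChoi v hv)

/-- The Haar-induced measure `dν` on channels. -/
def channelMeasure (v : a → EuclideanSpace ℂ (b × (a × b))) (hv : Orthonormal ℂ v) :
    Measure (Channel a b) :=
  (choiMeasure v hv).map (choiEquiv a b).symm

end Measures

/-! ### Fibres of the partial trace -/

section Fibre

variable {a b : Type*} [Fintype a] [Fintype b] [DecidableEq a] [DecidableEq b]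

theorem ptrRight_kronecker_conj (S : Matrix a a ℂ) (M : Matrix (a × b) (a × b) ℂ) :
    ptrRight ((S ⊗ₖ (1 : Matrix b b ℂ)) * M * (S ⊗ₖ (1 : Matrix b b ℂ))) =
      S * ptrRight M * S := by
  have h1 : ∀ p q, ((S ⊗ₖ (1 : Matrix b b ℂ)) * M) p q = ∑ i, S p.1 i * M (i, p.2) q := by
    intro p q
    simp [mul_apply, Fintype.sum_prod_type, kroneckerMap_apply, one_apply]
  have h2 : ∀ (N : Matrix (a × b) (a × b) ℂ) p q,
      (N * (S ⊗ₖ (1 : Matrix b b ℂ))) p q = ∑ j, N p (j, q.2) * S j q.1 := by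
    intro N p q
    simp [mul_apply, Fintype.sum_prod_type, kroneckerMap_apply, one_apply]
  ext i j
  simp only [ptrRight, of_apply, h1, h2, mul_apply, Finset.sum_mul, Finset.mul_sum]
  rw [Finset.sum_comm]
  refine Finset.sum_congr rfl fun _ _ => ?_
  rw [Finset.sum_comm]

theorem kronecker_conj_posSemidef {S : Matrix a a ℂ} (hS : S.IsHermitian)
    {M : Matrix (a × b) (a × b) ℂ} (hM : M.PosSemidef) :
    ((S ⊗ₖ (1 : Matrix b b ℂ)) * M * (S ⊗ₖ (1 : Matrix b b ℂ))).PosSemidef := by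
  have h := hM.mul_mul_conjTranspose_same (S ⊗ₖ (1 : Matrix b b ℂ))
  rwa [conjTranspose_kronecker, hS.eq, conjTranspose_one] at h

/-- Full-rank states. -/
abbrev FullRankState (a : Type*) [Fintype a] [DecidableEq a] : Type _ :=
  {y : State a // y.FullRank}

/-- The fibre `tr_B⁻¹(y)`. -/
def fibre (b : Type*) [Fintype b] (y : State a) : Set (State (a × b)) :=
  {σ | σ.marginal = y}

variable [Nonempty a]

/-- The bipartite state `d_A y^{1/2} J(Λ) y^{1/2}`, where `y^{1/2}` acts on `A`. -/
def combine (y : State a) (Λ : Channel a b) : State (a × b) :=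
  ⟨(Fintype.card a : ℂ) • ((y.sqrt ⊗ₖ (1 : Matrix b b ℂ)) * (choiEquiv a b Λ).1.1 *
      (y.sqrt ⊗ₖ (1 : Matrix b b ℂ))),
    (kronecker_conj_posSemidef y.sqrt_posSemidef.isHermitian (choiEquiv a b Λ).1.2.1).smul
      (by positivity), by
    have h : ptrRight (choiEquiv a b Λ).1.1 = (Fintype.card a : ℂ)⁻¹ • (1 : Matrix a a ℂ) :=
      (choiEquiv a b Λ).2
    rw [trace_smul, ← trace_ptrRight, ptrRight_kronecker_conj, h]
    simp [y.sqrt_mul_sqrt, y.2.2]⟩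

/-- The map `σ ↦ d_A⁻¹ y^{-1/2} σ y^{-1/2}` from the fibre over a full-rank `y` to Choi states. -/
def fibreToChoi (y : FullRankState a) (σ : fibre b y.1) : ChoiState a b :=
  have hm : ptrRight ((Fintype.card a : ℂ)⁻¹ • ((y.1.sqrt⁻¹ ⊗ₖ (1 : Matrix b b ℂ)) * σ.1.1 *
      (y.1.sqrt⁻¹ ⊗ₖ (1 : Matrix b b ℂ)))) = (Fintype.card a : ℂ)⁻¹ • (1 : Matrix a a ℂ) := by
    have hu := (isUnit_iff_isUnit_det _).mp y.2.isUnit_sqrt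
    have hs : ptrRight σ.1.1 = y.1.1 := congrArg Subtype.val σ.2
    have h : ∀ (c : ℂ) (N : Matrix (a × b) (a × b) ℂ), ptrRight (c • N) = c • ptrRight N := by
      intro c N; ext i j; simp [ptrRight, Finset.mul_sum]
    rw [h, ptrRight_kronecker_conj, hs, ← y.1.sqrt_mul_sqrt, nonsing_inv_mul_cancel_left _ _ hu,
      mul_nonsing_inv _ hu]
  ⟨⟨(Fintype.card a : ℂ)⁻¹ • ((y.1.sqrt⁻¹ ⊗ₖ (1 : Matrix b b ℂ)) * σ.1.1 *
      (y.1.sqrt⁻¹ ⊗ₖ (1 : Matrix b b ℂ))),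
    (kronecker_conj_posSemidef y.1.sqrt_posSemidef.inv.isHermitian σ.1.2.1).smul
      (by positivity), by rw [← trace_ptrRight, hm]; simp⟩, hm⟩

/-- The map `J_y⁻¹ : σ ↦ J⁻¹(d_A⁻¹ y^{-1/2} σ y^{-1/2})` from the fibre over a full-rank `y`
to channels. -/
def fibreToChannel (y : FullRankState a) (σ : fibre b y.1) : Channel a b :=
  (choiEquiv a b).symm (fibreToChoi y σ)

end Fibre

section Disintegration

variable {a b : Type*} [Fintype a] [Fintype b] [DecidableEq a] [DecidableEq b]

/-- `κ` is a family of probability measures on bipartite states, indexed (measurably) by the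
full-rank states `y` of `A`, with
`∫ dμ(σ) g(σ) = ∫ dμ_A(y) ∫_{tr_B⁻¹(y)} dκ_y(σ) g(σ)` for all measurable `g ≥ 0`,
where `μ_A` is the marginal of `μ`. -/
def IsDisintegration (μ : Measure (State (a × b))) (κ : Kernel (FullRankState a) (State (a × b))) :
    Prop :=
  IsMarkovKernel κ ∧
  ∀ g : State (a × b) → ℝ≥0∞, Measurable g →
    ∫⁻ σ, g σ ∂μ =
      ∫⁻ y : FullRankState a, ∫⁻ σ in fibre b y.1, g σ ∂(κ y)
        ∂((μ.map State.marginal).comap Subtype.val)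

end Disintegration

end ChannelMeasures

end

open ChannelMeasures

/-!
A pure state `ψ` on `A ⊗ (B ⊗ A'B')` is a matrix `M` with rows indexed by `A` and columns by
`BA'B'` (`coeffMatrix`). Its marginal on `A` is `y = M Mᴴ`, and a unitary `V` on `BA'B'` turns `M`
into `M Vᵀ`. If `y` has full rank, then `M = y^{1/2} W` with a matrix `W` whose rows are orthonormal
(`exists_orthonormal_sqrt_mul`), and for fixed `ψ` and Haar-random `V` the partial trace over `A'B'`
of the state with coefficients `y^{1/2} W Vᵀ` is `d_A y^{1/2} J(Λ) y^{1/2}`, where `Λ` is a random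
channel of law `ν`: any two orthonormal families are related by a unitary, so by unimodularity of
the compact group this law does not depend on `W` (`channelMeasure_eq`).

A Haar-random `ψ` has the same law after applying an independent Haar-random `1_A ⊗ V`. Averaging
over `V` first therefore gives `lintegral_stateMeasure`: the state `d_A y^{1/2} J(Λ) y^{1/2}` with
independent `y ∼ dσ_A` and `Λ ∼ ν` has law `dσ_AB`. The version with `yᵀ` follows since `dσ_A` is
invariant under transposition, complex conjugation being an automorphism of the unitary group
(`map_transpose_pureMeasure`).

That the marginal almost surely has full rank (`ae_fullRank_marginalMeasure`) is reduced to Lebesgue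
measure by `ae_haarUnitary_mulVec`, and there to the fact that `det (M + t)` has finitely many zeros
in `t`.

The conditional measure `ν_y` is the image of `ν` under `Λ ↦ d_A y^{1/2} J(Λ) y^{1/2}`, which for a
full-rank `y` is a Borel isomorphism onto the fibre over `y` (`fibreEquiv`). Uniqueness holds
because a disintegration determines the joint law of the marginal and the state on rectangles
(`IsDisintegration.compProd_prod`).
-/

namespace ChannelMeasures

/-! ### Topology and measurability of matrices, states and channels -/

section Measurability

variable {a b m n X : Type*} [Fintype a] [Fintype b] [Fintype m] [Fintype n] [MeasurableSpace X]

instance instSecondCountableTopologyMatrix : SecondCountableTopology (Matrix m n ℂ) :=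
  inferInstanceAs (SecondCountableTopology (m → n → ℂ))

instance instSecondCountableTopologyState : SecondCountableTopology (State n) :=
  TopologicalSpace.Subtype.secondCountableTopology {ρ : Matrix n n ℂ | ρ.PosSemidef ∧ ρ.trace = 1}

theorem measurable_matrix_iff {f : X → Matrix m n ℂ} :
    Measurable f ↔ ∀ i j, Measurable fun x => f x i j := by
  refine ⟨fun h i j => ?_, fun h => ?_⟩
  · exact measurable_pi_iff.mp (measurable_pi_iff.mp h i) j
  · exact measurable_pi_iff.mpr fun i => measurable_pi_iff.mpr fun j => h i j

theorem measurable_state_iff {f : X → State n} :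
    Measurable f ↔ ∀ i j, Measurable fun x => (f x).1 i j := by
  rw [← measurable_matrix_iff]
  exact measurable_comap_iff

theorem measurable_channel_iff {f : X → Channel a b} :
    Measurable f ↔ ∀ ρ, Measurable fun x => (f x).1 ρ := by
  rw [measurable_comap_iff, measurable_pi_iff]
  rfl

theorem continuous_marginal : Continuous (State.marginal : State (m × n) → State m) := by
  refine Continuous.subtype_mk ?_ _
  refine continuous_matrix fun i j => ?_
  simp only [ptrRight, of_apply]
  exact continuous_finsetSum _ fun k _ => continuous_subtype_val.matrix_elem _ _

theorem measurable_marginal : Measurable (State.marginal : State (m × n) → State m) :=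
  continuous_marginal.measurable

theorem continuous_transpose : Continuous (State.transpose : State n → State n) :=
  Continuous.subtype_mk (by fun_prop) _

theorem measurable_transpose : Measurable (State.transpose : State n → State n) :=
  continuous_transpose.measurable

variable [DecidableEq a] [DecidableEq b] [DecidableEq n]

theorem State.fullRank_iff_det_ne_zero (ρ : State n) : ρ.FullRank ↔ ρ.1.det ≠ 0 := by
  rw [← isUnit_iff_ne_zero, ← isUnit_iff_isUnit_det]
  refine ⟨fun h => ?_, fun h => rank_of_isUnit _ h⟩
  rw [← ρ.sqrt_mul_sqrt]
  exact h.isUnit_sqrt.mul h.isUnit_sqrt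

theorem measurableSet_fullRank : MeasurableSet {ρ : State n | ρ.FullRank} := by
  simp only [State.fullRank_iff_det_ne_zero]
  exact (isOpen_ne_fun (by fun_prop) continuous_const).measurableSet

open scoped Matrix.Norms.L2Operator in
/-- The topology of the entries is the one of the operator norm, for which the square root is
continuous on positive matrices. -/
theorem continuous_sqrt : Continuous (State.sqrt : State n → Matrix n n ℂ) := by
  have h := CFC.continuousOn_sqrt (A := Matrix n n ℂ)
  rw [continuousOn_iff_continuous_domRestrict] at h
  exact h.comp (f := fun ρ : State n =>
    (⟨ρ.1, nonneg_iff_posSemidef.mpr ρ.2.1⟩ : {M : Matrix n n ℂ | 0 ≤ M})) (by fun_prop)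

theorem continuous_conj (ρ : State n) :
    Continuous fun U : unitaryGroup n ℂ => ρ.conj U :=
  Continuous.subtype_mk (by fun_prop) _

theorem continuous_localUnitary :
    Continuous (localUnitary a : unitaryGroup n ℂ → unitaryGroup (a × n) ℂ) := by
  refine Continuous.subtype_mk (continuous_matrix fun i j => ?_) _
  simp only [kroneckerMap_apply]
  exact continuous_const.mul (continuous_subtype_val.matrix_elem _ _)

theorem continuous_reindex (e : m ≃ n) : Continuous (State.reindex e) :=
  Continuous.subtype_mk (continuous_subtype_val.matrix_submatrix _ _) _

theorem measurableSet_fibre (y : State a) : MeasurableSet (fibre b y) :=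
  measurable_marginal (measurableSet_singleton y)

variable [Nonempty a]

theorem measurable_choiEquiv : Measurable (choiEquiv a b) := by
  refine measurable_comap_iff.mpr (measurable_state_iff.mpr fun p q => ?_)
  have : (fun Λ : Channel a b => (choiEquiv a b Λ).1.1 p q) =
      fun Λ => (Fintype.card a : ℂ)⁻¹ * Λ.1 (single p.1 q.1 1) p.2 q.2 :=
    funext fun Λ => choiMatrix_apply _ _ _
  change Measurable fun Λ : Channel a b => (choiEquiv a b Λ).1.1 p q
  rw [this]
  exact (measurable_matrix_iff.mp
    (measurable_channel_iff.mp measurable_id (single p.1 q.1 1)) p.2 q.2).const_mul _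

theorem measurable_choiEquiv_symm : Measurable (choiEquiv a b).symm := by
  refine measurable_channel_iff.mpr fun ρ => measurable_matrix_iff.mpr fun x y => ?_
  have h : ∀ i j, Measurable fun C : ChoiState a b => C.1.1 (i, x) (j, y) := fun i j =>
    measurable_state_iff.mp measurable_subtype_coe _ _
  have : (fun C : ChoiState a b => ((choiEquiv a b).symm C).1 ρ x y) =
      fun C => (Fintype.card a : ℂ) * ∑ i, ∑ j, C.1.1 (i, x) (j, y) * ρ i j :=
    funext fun C => choiInverse_apply _ _ _ _
  rw [this]
  exact (Finset.measurable_fun_sum _ fun i _ => Finset.measurable_fun_sum _ fun j _ =>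
    (h i j).mul_const _).const_mul _

theorem combine_val (y : State a) (Λ : Channel a b) :
    (combine y Λ).1 = (Fintype.card a : ℂ) • ((y.sqrt ⊗ₖ (1 : Matrix b b ℂ)) *
      (choiEquiv a b Λ).1.1 * (y.sqrt ⊗ₖ (1 : Matrix b b ℂ))) := rfl

theorem measurable_combine :
    Measurable fun p : State a × Channel a b => combine p.1 p.2 := by
  have h1 : Continuous fun q : Matrix a a ℂ × Matrix (a × b) (a × b) ℂ =>
      (Fintype.card a : ℂ) • ((q.1 ⊗ₖ (1 : Matrix b b ℂ)) * q.2 *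
        (q.1 ⊗ₖ (1 : Matrix b b ℂ))) := by
    have h2 : Continuous fun q : Matrix a a ℂ × Matrix (a × b) (a × b) ℂ =>
        q.1 ⊗ₖ (1 : Matrix b b ℂ) := by
      refine continuous_matrix fun i j => ?_
      simp only [kroneckerMap_apply]
      exact (continuous_fst.matrix_elem _ _).mul continuous_const
    exact Continuous.const_smul ((h2.matrix_mul continuous_snd).matrix_mul h2)
      (Fintype.card a : ℂ)
  have h4 : Measurable fun p : State a × Channel a b =>
      (p.1.sqrt, ((choiEquiv a b) p.2).1.1) :=
    (continuous_sqrt.measurable.comp measurable_fst).prodMk (measurable_subtype_coe.comp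
      (measurable_subtype_coe.comp (measurable_choiEquiv.comp measurable_snd)))
  refine measurable_comap_iff.mpr ?_
  have h5 : (Subtype.val ∘ fun p : State a × Channel a b => combine p.1 p.2) =
      fun p => (Fintype.card a : ℂ) • ((p.1.sqrt ⊗ₖ (1 : Matrix b b ℂ)) *
        (choiEquiv a b p.2).1.1 * (p.1.sqrt ⊗ₖ (1 : Matrix b b ℂ))) :=
    funext fun p => combine_val p.1 p.2
  have h6 := h1.measurable.comp h4
  rw [h5]
  exact h6

theorem measurable_combine_left (y : State a) :
    Measurable (combine y : Channel a b → State (a × b)) := by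
  have h : Measurable fun Λ : Channel a b => (y, Λ) := measurable_prodMk_left
  have h' :=
    Measurable.comp (g := fun p : State a × Channel a b => combine p.1 p.2) measurable_combine h
  exact h'

theorem continuous_randomChoi (v : a → EuclideanSpace ℂ (b × (a × b))) (hv : Orthonormal ℂ v) :
    Continuous (randomChoi v hv) :=
  Continuous.subtype_mk (continuous_marginal.comp ((continuous_reindex _).comp
    ((continuous_conj _).comp continuous_localUnitary))) _

theorem measurable_fibreToChannel (y : FullRankState a) :
    Measurable (fibreToChannel y : fibre b y.1 → Channel a b) := by
  have h : Continuous fun σ : fibre b y.1 => (Fintype.card a : ℂ)⁻¹ •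
      ((y.1.sqrt⁻¹ ⊗ₖ (1 : Matrix b b ℂ)) * σ.1.1 * (y.1.sqrt⁻¹ ⊗ₖ (1 : Matrix b b ℂ))) := by
    have : Continuous fun σ : fibre b y.1 => σ.1.1 := by fun_prop
    exact Continuous.const_smul ((continuous_const.matrix_mul this).matrix_mul continuous_const)
      (Fintype.card a : ℂ)⁻¹
  exact measurable_choiEquiv_symm.comp
    (measurable_comap_iff.mpr (measurable_comap_iff.mpr h.measurable))

end Measurability

/-! ### Haar measure on the unitary group -/

section Haar

variable {n : Type*} [Fintype n] [DecidableEq n]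

instance instSecondCountableTopologyUnitaryGroup : SecondCountableTopology (unitaryGroup n ℂ) :=
  TopologicalSpace.Subtype.secondCountableTopology (unitaryGroup n ℂ : Set (Matrix n n ℂ))

instance instIsHaarMeasureHaarUnitary : (haarUnitary n).IsHaarMeasure :=
  inferInstanceAs (Measure.haarMeasure _).IsHaarMeasure

instance instIsProbabilityMeasureHaarUnitary : IsProbabilityMeasure (haarUnitary n) :=
  ⟨by simpa [haarUnitary] using
    Measure.haarMeasure_self (K₀ := (⊤ : TopologicalSpace.PositiveCompacts (unitaryGroup n ℂ)))⟩

/-- A compact group is unimodular: Haar measure is also invariant under right translations. -/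
instance instIsMulRightInvariantHaarUnitary : (haarUnitary n).IsMulRightInvariant := by
  refine ⟨fun V => ?_⟩
  have hm : Measurable fun U : unitaryGroup n ℂ => U * V := (continuous_mul_const V).measurable
  have : IsProbabilityMeasure ((haarUnitary n).map fun U => U * V) :=
    Measure.isProbabilityMeasure_map hm.aemeasurable
  exact Measure.isHaarMeasure_eq_of_isProbabilityMeasure _ _

end Haar

/-! ### Transitivity of the unitary group on orthonormal families -/

section Transitivity

variable {ι n : Type*} [Fintype ι] [Fintype n] [DecidableEq n]

/-- An orthonormal family is, up to an injection of index sets, part of the columns of a unitary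
matrix. -/
theorem exists_unitary_mulVec_single {v : ι → EuclideanSpace ℂ n} (hv : Orthonormal ℂ v)
    (f : ι ↪ n) : ∃ V : unitaryGroup n ℂ, ∀ i, V.1 *ᵥ Pi.single (f i) 1 = (v i).ofLp := by
  let e := Equiv.ofInjective f f.injective
  have hr : (Set.range f).domRestrict (Function.extend f v 0) = v ∘ e.symm := by
    funext x
    obtain ⟨i, rfl⟩ := e.surjective x
    simp [e, f.injective.extend_apply]
  obtain ⟨B, hB⟩ := Orthonormal.exists_orthonormalBasis_extension_of_card_eq (𝕜 := ℂ)
    (finrank_euclideanSpace (𝕜 := ℂ) (ι := n)) (v := Function.extend f v 0) (s := Set.range f)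
    (hr ▸ hv.comp _ e.symm.injective)
  refine ⟨⟨_, (EuclideanSpace.basisFun n ℂ).toMatrix_orthonormalBasis_mem_unitary B⟩,
    fun i => ?_⟩
  rw [mulVec_single_one, ← f.injective.extend_apply v 0, ← hB _ ⟨i, rfl⟩]
  ext k
  simp [Matrix.col_apply, Module.Basis.toMatrix_apply]

theorem exists_unitary_mulVec_eq {v w : ι → EuclideanSpace ℂ n} (hv : Orthonormal ℂ v)
    (hw : Orthonormal ℂ w) :
    ∃ V : unitaryGroup n ℂ, ∀ i, V.1 *ᵥ (v i).ofLp = (w i).ofLp := by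
  -- Both families are completed to bases along the same injection of index sets.
  have hcard : Fintype.card ι ≤ Fintype.card n := by
    simpa using hv.linearIndependent.fintype_card_le_finrank
  obtain ⟨f⟩ := Function.Embedding.nonempty_of_card_le hcard
  obtain ⟨A, hA⟩ := exists_unitary_mulVec_single hv f
  obtain ⟨B, hB⟩ := exists_unitary_mulVec_single hw f
  refine ⟨B * star A, fun i => ?_⟩
  rw [← hA, ← hB, mulVec_mulVec]
  change (B.1 * star A.1 * A.1) *ᵥ _ = _
  rw [mul_assoc, mem_unitaryGroup_iff'.mp A.2, mul_one]

theorem exists_unitary_mulVec_eq_of_norm {x y : EuclideanSpace ℂ n} (hx : ‖x‖ = 1)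
    (hy : ‖y‖ = 1) : ∃ V : unitaryGroup n ℂ, V.1 *ᵥ x.ofLp = y.ofLp := by
  obtain ⟨V, hV⟩ := exists_unitary_mulVec_eq (v := fun _ : Unit => x) (w := fun _ => y)
    ⟨fun _ => hx, fun i j h => (h (Subsingleton.elim i j)).elim⟩
    ⟨fun _ => hy, fun i j h => (h (Subsingleton.elim i j)).elim⟩
  exact ⟨V, hV ()⟩

end Transitivity

/-! ### Pure states as coefficient matrices -/

section Coefficients

variable {a b c : Type*} [Fintype a] [Fintype b] [Fintype c]

/-- The coefficients of a vector of `(ℂᵃ ⊗ ℂᵇ) ⊗ ℂᶜ`, as a matrix from `ℂᵇ ⊗ ℂᶜ` to `ℂᵃ`. -/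
def coeffMatrix (ψ : (a × b) × c → ℂ) : Matrix a (b × c) ℂ :=
  of fun i k => ψ ((i, k.1), k.2)

/-- The partial trace over `ℂᶜ` of `|ψ⟩⟨ψ|`, where `ψ` has coefficient matrix `M`. -/
def envTrace (M : Matrix a (b × c) ℂ) : Matrix (a × b) (a × b) ℂ :=
  of fun p q => ∑ r, M p.1 (p.2, r) * star (M q.1 (q.2, r))

theorem ptrRight_envTrace (M : Matrix a (b × c) ℂ) : ptrRight (envTrace M) = M * Mᴴ := by
  ext i j
  simp [ptrRight, envTrace, mul_apply, Fintype.sum_prod_type]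

theorem envTrace_smul (z : ℂ) (M : Matrix a (b × c) ℂ) :
    envTrace (z • M) = (z * star z) • envTrace M := by
  ext p q
  simp only [envTrace, of_apply, Matrix.smul_apply, smul_eq_mul, star_mul', Finset.mul_sum]
  exact Finset.sum_congr rfl fun _ _ => by ring

variable [DecidableEq a] [DecidableEq b] [DecidableEq c]

/-- Operators on `A` commute with the partial trace over `ℂᶜ`. -/
theorem kronecker_conj_envTrace (S : Matrix a a ℂ) (M : Matrix a (b × c) ℂ) :
    (S ⊗ₖ (1 : Matrix b b ℂ)) * envTrace M * (S ⊗ₖ (1 : Matrix b b ℂ))ᴴ = envTrace (S * M) := by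
  have h1 : ∀ (N : Matrix (a × b) (a × b) ℂ) p q,
      ((S ⊗ₖ (1 : Matrix b b ℂ)) * N) p q = ∑ i, S p.1 i * N (i, p.2) q := by
    intro N p q
    simp [mul_apply, Fintype.sum_prod_type, kroneckerMap_apply, one_apply]
  have h2 : ∀ (N : Matrix (a × b) (a × b) ℂ) p q,
      (N * (S ⊗ₖ (1 : Matrix b b ℂ))ᴴ) p q = ∑ j, N p (j, q.2) * star (S q.1 j) := by
    intro N p q
    simp [mul_apply, Fintype.sum_prod_type, kroneckerMap_apply, one_apply, apply_ite]
  ext p q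
  rw [h2]
  simp only [h1, envTrace, of_apply, mul_apply, star_sum, star_mul', Finset.sum_mul,
    Finset.mul_sum]
  rw [Finset.sum_comm]
  simp_rw [Finset.sum_comm (t := (Finset.univ : Finset c))]
  refine Finset.sum_congr rfl fun _ _ => ?_
  rw [Finset.sum_comm]
  exact Finset.sum_congr rfl fun _ _ => Finset.sum_congr rfl fun _ _ => by ring

/-- The unitary `1_A ⊗ V` on `(ℂᵃ ⊗ ℂᵇ) ⊗ ℂᶜ`, for a unitary `V` on `ℂᵇ ⊗ ℂᶜ`. -/
def envUnitary (a : Type*) [Fintype a] [DecidableEq a] (V : unitaryGroup (b × c) ℂ) :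
    unitaryGroup ((a × b) × c) ℂ :=
  ⟨(localUnitary a V).1.submatrix (Equiv.prodAssoc a b c) (Equiv.prodAssoc a b c), by
    rw [mem_unitaryGroup_iff, star_eq_conjTranspose, conjTranspose_submatrix,
      submatrix_mul_equiv, ← star_eq_conjTranspose, mem_unitaryGroup_iff.mp (localUnitary a V).2,
      submatrix_one_equiv]⟩

theorem coeffMatrix_envUnitary_mulVec (V : unitaryGroup (b × c) ℂ) (ψ : (a × b) × c → ℂ) :
    coeffMatrix ((envUnitary a V).1 *ᵥ ψ) = coeffMatrix ψ * V.1ᵀ := by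
  ext i k
  simp only [coeffMatrix, envUnitary, localUnitary, of_apply, mulVec, dotProduct, mul_apply,
    transpose_apply, submatrix_apply, kroneckerMap_apply, Fintype.sum_prod_type,
    Equiv.prodAssoc_apply, one_apply]
  simp [mul_comm]

theorem conj_pureState_val {n : Type*} [Fintype n] [DecidableEq n] (ψ : EuclideanSpace ℂ n)
    (hψ : ‖ψ‖ = 1) (U : unitaryGroup n ℂ) :
    ((pureState ψ hψ).conj U).1 = vecMulVec (U.1 *ᵥ ψ.ofLp) (star (U.1 *ᵥ ψ.ofLp)) := by
  simp only [State.conj, pureState, star_eq_conjTranspose]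
  rw [mul_vecMulVec, vecMulVec_mul, star_mulVec]

theorem marginal_conj_pureState_val (ψ : EuclideanSpace ℂ ((a × b) × c)) (hψ : ‖ψ‖ = 1)
    (U : unitaryGroup ((a × b) × c) ℂ) :
    ((pureState ψ hψ).conj U).marginal.1 = envTrace (coeffMatrix (U.1 *ᵥ ψ.ofLp)) := by
  change ptrRight ((pureState ψ hψ).conj U).1 = _
  rw [conj_pureState_val]
  rfl

variable [Nonempty a]

theorem randomChoi_val (v : a → EuclideanSpace ℂ (b × (a × b))) (hv : Orthonormal ℂ v)
    (U : unitaryGroup (b × (a × b)) ℂ) :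
    (randomChoi v hv U).1.1 =
      (Fintype.card a : ℂ)⁻¹ • envTrace (of (fun i => (v i).ofLp) * U.1ᵀ) := by
  have h0 : ((√(Fintype.card a : ℝ) : ℝ) : ℂ)⁻¹ * star ((√(Fintype.card a : ℝ) : ℝ) : ℂ)⁻¹
      = (Fintype.card a : ℂ)⁻¹ := by
    rw [star_inv₀, Complex.star_def, Complex.conj_ofReal, ← mul_inv, ← Complex.ofReal_mul,
      Real.mul_self_sqrt (by positivity)]
    simp
  refine Eq.trans ?_ ((envTrace_smul _ _).trans (congrArg (· • _) h0))
  have h1 : ∀ i k, ((localUnitary a U).1 *ᵥ (referenceVector v).ofLp) (i, k) =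
      (((√(Fintype.card a : ℝ) : ℝ) : ℂ)⁻¹ • (of (fun i => (v i).ofLp) * U.1ᵀ)) i k := by
    intro i k
    simp only [localUnitary, mulVec, dotProduct, Fintype.sum_prod_type (f := fun x : a × _ => _),
      kroneckerMap_apply, referenceVector, one_apply, Matrix.smul_apply, mul_apply, of_apply,
      transpose_apply, smul_eq_mul, Finset.mul_sum]
    rw [Finset.sum_eq_single i]
    · exact Finset.sum_congr rfl fun _ _ => by simp; ring
    · intro j _ hj
      simp [hj.symm]
    · simp
  ext p q
  change ∑ r, ((pureState (referenceVector v) (norm_referenceVector hv)).conj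
    (localUnitary a U)).1 (p.1, (p.2, r)) (q.1, (q.2, r)) = _
  rw [conj_pureState_val]
  simp only [vecMulVec_apply, Pi.star_apply, h1, envTrace, of_apply]

end Coefficients

/-! ### Haar-random unit vectors -/

section RandomVector

variable {n : Type*} [Fintype n] [DecidableEq n]

theorem continuous_conj_pureState (ψ : EuclideanSpace ℂ n) (hψ : ‖ψ‖ = 1) :
    Continuous fun U : unitaryGroup n ℂ => (pureState ψ hψ).conj U :=
  continuous_conj _

/-- The law of a Haar-random pure state does not depend on the reference vector. -/
theorem pureMeasure_eq (ψ φ : EuclideanSpace ℂ n) (hψ : ‖ψ‖ = 1) (hφ : ‖φ‖ = 1) :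
    pureMeasure ψ hψ = pureMeasure φ hφ := by
  obtain ⟨V, hV⟩ := exists_unitary_mulVec_eq_of_norm hφ hψ
  have h : (fun U : unitaryGroup n ℂ => (pureState ψ hψ).conj U) =
      (fun U => (pureState φ hφ).conj U) ∘ fun U => U * V := by
    funext U
    refine Subtype.ext ?_
    rw [Function.comp_apply, conj_pureState_val, conj_pureState_val, ← hV, mulVec_mulVec]
    rfl
  rw [pureMeasure, h, ← Measure.map_map (continuous_conj_pureState φ hφ).measurable
    (measurable_mul_const V), map_mul_right_eq_self]
  rfl

/-- Entrywise complex conjugation, as an automorphism of the unitary group. -/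
def conjHom (n : Type*) [Fintype n] [DecidableEq n] : unitaryGroup n ℂ →* unitaryGroup n ℂ where
  toFun U := ⟨U.1.map star, by
    rw [mem_unitaryGroup_iff]
    have h := congrArg (fun M : Matrix n n ℂ => M.map (starRingEnd ℂ))
      (mem_unitaryGroup_iff.mp U.2)
    rw [Matrix.map_mul, Matrix.map_one _ (map_zero _) (map_one _)] at h
    have h' : star (U.1.map star) = (star U.1).map star := by ext i j; simp [star_apply]
    rw [h']
    exact h⟩
  map_one' := Subtype.ext (by simp)
  map_mul' U V := Subtype.ext (Matrix.map_mul (f := starRingEnd ℂ))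

theorem conjHom_conjHom (U : unitaryGroup n ℂ) : conjHom n (conjHom n U) = U := by
  refine Subtype.ext ?_
  ext i j
  simp [conjHom]

theorem continuous_conjHom : Continuous (conjHom n) :=
  Continuous.subtype_mk (continuous_subtype_val.matrix_map continuous_star) _

theorem map_conjHom_haarUnitary : (haarUnitary n).map (conjHom n) = haarUnitary n := by
  have : IsProbabilityMeasure ((haarUnitary n).map (conjHom n)) :=
    Measure.isProbabilityMeasure_map continuous_conjHom.measurable.aemeasurable
  have := Measure.isHaarMeasure_map_of_isFiniteMeasure (haarUnitary n) (conjHom n)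
    continuous_conjHom fun U => ⟨_, conjHom_conjHom U⟩
  exact Measure.isHaarMeasure_eq_of_isProbabilityMeasure _ _

/-- The law of a Haar-random pure state is invariant under transposition: transposing replaces
`U ψ` by its complex conjugate `Ū ψ̄`, and complex conjugation preserves Haar measure. -/
theorem map_transpose_pureMeasure (ψ : EuclideanSpace ℂ n) (hψ : ‖ψ‖ = 1) :
    (pureMeasure ψ hψ).map State.transpose = pureMeasure ψ hψ := by
  let φ : EuclideanSpace ℂ n := WithLp.toLp 2 (star ψ.ofLp)
  have hφ : ‖φ‖ = 1 := by
    rw [← hψ, EuclideanSpace.norm_eq, EuclideanSpace.norm_eq]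
    simp [φ]
  have h : State.transpose ∘ (fun U : unitaryGroup n ℂ => (pureState ψ hψ).conj U) =
      (fun U => (pureState φ hφ).conj U) ∘ conjHom n := by
    funext U
    refine Subtype.ext ?_
    have h1 : (conjHom n U).1 *ᵥ φ.ofLp = star (U.1 *ᵥ ψ.ofLp) := by
      ext i
      simp [conjHom, φ, mulVec, dotProduct]
    rw [Function.comp_apply, Function.comp_apply, conj_pureState_val, h1, star_star]
    change ((pureState ψ hψ).conj U).1ᵀ = _
    rw [conj_pureState_val, transpose_vecMulVec]
  conv_rhs => rw [pureMeasure_eq ψ φ hψ hφ]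
  rw [pureMeasure, Measure.map_map measurable_transpose
    (continuous_conj_pureState ψ hψ).measurable, h,
    ← Measure.map_map (continuous_conj_pureState φ hφ).measurable continuous_conjHom.measurable,
    map_conjHom_haarUnitary]
  rfl

/-- A measurable property that holds almost everywhere on every line of a fixed direction holds
almost everywhere: average over the translates along that direction. -/
theorem ae_of_forall_ae_line {E : Type*} [NormedAddCommGroup E] [NormedSpace ℝ E]
    [MeasurableSpace E] [BorelSpace E] [SecondCountableTopology E] (μ : Measure E) [SFinite μ]
    [μ.IsAddRightInvariant] {p : E → Prop} (hp : MeasurableSet {x | p x}) (z : E)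
    (h : ∀ x, ∀ᵐ t : ℝ, p (x + t • z)) : ∀ᵐ x ∂μ, p x := by
  have hm : MeasurableSet {q : E × ℝ | p (q.1 + q.2 • z)} :=
    (show Continuous fun q : E × ℝ => q.1 + q.2 • z by fun_prop).measurable hp
  have h1 : ∀ᵐ x ∂μ, ∀ᵐ t : ℝ, p (x + t • z) := Filter.Eventually.of_forall h
  rw [Measure.ae_ae_comm hm] at h1
  obtain ⟨t, ht⟩ := h1.exists
  have h2 := ae_map_iff (μ := μ) (f := fun x => x + t • z) (by fun_prop) hp
  rw [map_add_right_eq_self] at h2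
  exact h2.mpr ht

/-- A property of vectors that is generic for Lebesgue measure and invariant under scaling holds
almost surely for a Haar-random unit vector. By Fubini some vector `x` has the property after
almost every unitary, `x` is not zero, and every unit vector is a unitary image of a multiple
of `x`. -/
theorem ae_haarUnitary_mulVec {p : (n → ℂ) → Prop} (hp : MeasurableSet {x | p x}) (z : n → ℂ)
    (hline : ∀ x, ∀ᵐ t : ℝ, p (x + t • z)) (h0 : ¬ p 0) (hs : ∀ (r : ℝ) x, p (r • x) → p x)
    {ψ : EuclideanSpace ℂ n} (hψ : ‖ψ‖ = 1) :
    ∀ᵐ U : unitaryGroup n ℂ ∂(haarUnitary n), p (U.1 *ᵥ ψ.ofLp) := by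
  have hcont : Continuous fun q : unitaryGroup n ℂ × (n → ℂ) => q.1.1 *ᵥ q.2 :=
    (continuous_subtype_val.comp continuous_fst).matrix_mulVec continuous_snd
  have h1 : ∀ᵐ U : unitaryGroup n ℂ ∂(haarUnitary n), ∀ᵐ x : n → ℂ, p (U.1 *ᵥ x) := by
    refine Filter.Eventually.of_forall fun U => ?_
    have hU : Continuous fun x : n → ℂ => U.1 *ᵥ x := hcont.comp (by fun_prop : Continuous (U, ·))
    refine ae_of_forall_ae_line volume (p := fun x => p (U.1 *ᵥ x)) (hU.measurable hp)
      (star U.1 *ᵥ z) fun x => ?_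
    have : ∀ t : ℝ, U.1 *ᵥ (x + t • (star U.1 *ᵥ z)) = U.1 *ᵥ x + t • z := fun t => by
      rw [mulVec_add, mulVec_smul, mulVec_mulVec, mem_unitaryGroup_iff.mp U.2, one_mulVec]
    simpa only [this] using hline (U.1 *ᵥ x)
  rw [Measure.ae_ae_comm (p := fun (U : unitaryGroup n ℂ) (x : n → ℂ) => p (U.1 *ᵥ x))
    (hcont.measurable hp)] at h1
  obtain ⟨x, hx⟩ := h1.exists
  have hx0 : WithLp.toLp 2 x ≠ (0 : EuclideanSpace ℂ n) := by
    rintro hx0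
    obtain ⟨U, hU⟩ := hx.exists
    have : x = 0 := congrArg WithLp.ofLp hx0
    rw [this, mulVec_zero] at hU
    exact h0 hU
  set r : ℝ := ‖(WithLp.toLp 2 x : EuclideanSpace ℂ n)‖ with hr
  have hr0 : r ≠ 0 := norm_ne_zero_iff.mpr hx0
  let φ : EuclideanSpace ℂ n := r⁻¹ • WithLp.toLp 2 x
  have hφ : ‖φ‖ = 1 := by
    simp only [φ, norm_smul, norm_inv, Real.norm_eq_abs, ← hr]
    rw [abs_of_nonneg (norm_nonneg _), inv_mul_cancel₀ hr0]
  have hxφ : x = r • φ.ofLp := by simp [φ, smul_smul, hr0]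
  obtain ⟨V, hV⟩ := exists_unitary_mulVec_eq_of_norm hψ hφ
  have hψm : MeasurableSet {U : unitaryGroup n ℂ | p (U.1 *ᵥ ψ.ofLp)} :=
    (hcont.comp (by fun_prop : Continuous fun U : unitaryGroup n ℂ => (U, ψ.ofLp))).measurable hp
  have h2 := ae_map_iff (μ := haarUnitary n) (measurable_mul_const V).aemeasurable hψm
  rw [map_mul_right_eq_self] at h2
  refine h2.mpr ?_
  filter_upwards [hx] with U hU
  refine hs r _ ?_
  change p (r • ((U.1 * V.1) *ᵥ ψ.ofLp))
  rwa [← mulVec_mulVec, hV, ← mulVec_smul, ← hxφ]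

end RandomVector

/-! ### Marginals of random states have full rank -/

section FullRank

variable {a b c : Type*} [Fintype a] [Fintype b] [Fintype c]
  [DecidableEq a] [DecidableEq b] [DecidableEq c]

/-- The exceptional `t` are the real roots of the characteristic polynomial of `-M`. -/
theorem ae_det_add_smul_one_ne_zero (M : Matrix a a ℂ) :
    ∀ᵐ t : ℝ, (M + t • (1 : Matrix a a ℂ)).det ≠ 0 := by
  have hfin : {t : ℝ | ((-M).charpoly).IsRoot (t : ℂ)}.Finite :=
    ((-M).charpoly.finite_setOfPred_isRoot (charpoly_monic _).ne_zero).preimage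
      Complex.ofReal_injective.injOn
  refine (measure_mono_null (fun t ht => ?_) (hfin.measure_zero volume) :)
  have ht' : (M + t • (1 : Matrix a a ℂ)).det = 0 := by simpa using ht
  change ((-M).charpoly).eval (t : ℂ) = 0
  rw [eval_charpoly, ← ht', sub_neg_eq_add, add_comm]
  congr 2
  ext i j
  simp [one_apply, diagonal_apply]

theorem det_mul_conjTranspose_ne_zero {d : Type*} [Fintype d] {M : Matrix a d ℂ} (f : a → d)
    (h : (M.submatrix id f).det ≠ 0) : (M * Mᴴ).det ≠ 0 := by
  refine (PosDef.mul_conjTranspose_self M fun x y hxy => ?_).det_pos.ne'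
  refine vecMul_injective_of_isUnit ((isUnit_iff_isUnit_det _).mpr (isUnit_iff_ne_zero.mpr h)) ?_
  funext j
  exact congrFun hxy (f j)

/-- The first marginal of a Haar-random pure state on `(ℂᵃ ⊗ ℂᵇ) ⊗ ℂᶜ` almost surely has full
rank, provided that `a` embeds into `b × c`. -/
theorem ae_fullRank_marginal [Nonempty a] (f : a ↪ b × c) (ψ : EuclideanSpace ℂ ((a × b) × c))
    (hψ : ‖ψ‖ = 1) :
    ∀ᵐ U ∂(haarUnitary ((a × b) × c)),
      ((pureState ψ hψ).conj U).marginal.marginal.FullRank := by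
  have hadd : ∀ x y : (a × b) × c → ℂ, (coeffMatrix (x + y)).submatrix id f =
      (coeffMatrix x).submatrix id f + (coeffMatrix y).submatrix id f := fun _ _ => rfl
  have hsmul : ∀ (r : ℝ) (x : (a × b) × c → ℂ), (coeffMatrix (r • x)).submatrix id f =
      r • (coeffMatrix x).submatrix id f := fun _ _ => rfl
  have h := ae_haarUnitary_mulVec (n := (a × b) × c)
    (p := fun x => ((coeffMatrix x).submatrix id f).det ≠ 0) ?_
    (fun k => if (k.1.2, k.2) = f k.1.1 then 1 else 0) ?_ ?_ ?_ hψ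
  · filter_upwards [h] with U hU
    rw [State.fullRank_iff_det_ne_zero]
    change (ptrRight ((pureState ψ hψ).conj U).marginal.1).det ≠ 0
    rw [marginal_conj_pureState_val, ptrRight_envTrace]
    exact det_mul_conjTranspose_ne_zero f hU
  · refine (isOpen_ne_fun ?_ continuous_const).measurableSet
    refine Continuous.matrix_det (continuous_matrix fun i j => ?_)
    exact continuous_apply _
  · -- The direction is chosen so that the selected `a × a` block moves by multiples of `1`.
    intro x
    have h1 : (coeffMatrix fun k : (a × b) × c =>
        if (k.1.2, k.2) = f k.1.1 then (1 : ℂ) else 0).submatrix id f = 1 := by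
      ext i j
      simp [coeffMatrix, one_apply, eq_comm]
    simp only [hadd, hsmul, h1]
    exact ae_det_add_smul_one_ne_zero _
  · have h2 : (coeffMatrix (0 : (a × b) × c → ℂ)).submatrix id f = 0 := rfl
    simp [h2]
  · intro r x hx hx0
    refine hx ?_
    rw [hsmul]
    have : r • (coeffMatrix x).submatrix id f = (r : ℂ) • (coeffMatrix x).submatrix id f := by
      ext i j; simp
    rw [this, det_smul, hx0, mul_zero]

end FullRank

/-! ### The factorization of the Haar-induced measure on states -/

section Factorization

variable {a b : Type*} [Fintype a] [Fintype b] [DecidableEq a] [DecidableEq b]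

theorem continuous_envUnitary {c : Type*} [Fintype c] [DecidableEq c] :
    Continuous (envUnitary a : unitaryGroup (b × c) ℂ → unitaryGroup ((a × b) × c) ℂ) :=
  Continuous.subtype_mk
    ((continuous_subtype_val.comp continuous_localUnitary).matrix_submatrix _ _) _

/-- The polar decomposition of a coefficient matrix of full rank: the rows of `y^{-1/2} M` are
orthonormal when `M Mᴴ = y`. -/
theorem exists_orthonormal_sqrt_mul {d : Type*} [Fintype d] {y : State a} (hy : y.FullRank)
    {M : Matrix a d ℂ} (hM : M * Mᴴ = y.1) :
    ∃ w : a → EuclideanSpace ℂ d, Orthonormal ℂ w ∧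
      y.sqrt * of (fun i => (w i).ofLp) = M := by
  have hu := (isUnit_iff_isUnit_det _).mp hy.isUnit_sqrt
  have hW : (y.sqrt⁻¹ * M) * (y.sqrt⁻¹ * M)ᴴ = 1 := by
    rw [conjTranspose_mul, conjTranspose_nonsing_inv, y.sqrt_posSemidef.isHermitian.eq,
      Matrix.mul_assoc, ← Matrix.mul_assoc M, hM, ← y.sqrt_mul_sqrt, mul_assoc,
      mul_nonsing_inv _ hu, mul_one, nonsing_inv_mul _ hu]
  refine ⟨fun i => WithLp.toLp 2 ((y.sqrt⁻¹ * M) i), orthonormal_iff_ite.mpr fun i j => ?_, ?_⟩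
  · have h := congrFun (congrFun hW j) i
    rw [mul_apply, one_apply] at h
    rw [EuclideanSpace.inner_eq_star_dotProduct]
    simp only [eq_comm (a := i), ← h]
    rfl
  · exact mul_nonsing_inv_cancel_left _ _ hu

variable [Nonempty a]

/-- The law of the random channel does not depend on the reference family. -/
theorem channelMeasure_eq (v w : a → EuclideanSpace ℂ (b × (a × b))) (hv : Orthonormal ℂ v)
    (hw : Orthonormal ℂ w) : channelMeasure v hv = channelMeasure w hw := by
  obtain ⟨V, hV⟩ := exists_unitary_mulVec_eq hw hv
  have h : randomChoi v hv = randomChoi w hw ∘ fun U => U * V := by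
    funext U
    refine Subtype.ext (Subtype.ext ?_)
    have h1 : (of fun i => (v i).ofLp) = (of fun i => (w i).ofLp) * V.1ᵀ := by
      ext i k
      simp [← hV, mul_apply, mulVec, dotProduct, mul_comm]
    rw [Function.comp_apply, randomChoi_val, randomChoi_val, h1, Matrix.mul_assoc, ← transpose_mul]
    rfl
  rw [channelMeasure, channelMeasure, choiMeasure, h,
    ← Measure.map_map (continuous_randomChoi w hw).measurable (measurable_mul_const V),
    map_mul_right_eq_self]
  rfl

/-- For `Λ` the channel of the Choi state obtained from `d_A^{-1/2} ∑ᵢ |i⟩ V|wᵢ⟩`, the state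
`d_A y^{1/2} J(Λ) y^{1/2}` is the partial trace of the pure state with coefficients
`y^{1/2} W Vᵀ`, where `W` has the rows `wᵢ`. -/
theorem combine_randomChoi_val (y : State a) (w : a → EuclideanSpace ℂ (b × (a × b)))
    (hw : Orthonormal ℂ w) (V : unitaryGroup (b × (a × b)) ℂ) :
    (combine y ((choiEquiv a b).symm (randomChoi w hw V))).1 =
      envTrace (y.sqrt * of (fun i => (w i).ofLp) * V.1ᵀ) := by
  have hd : (Fintype.card a : ℂ) ≠ 0 := by simp
  have h := kronecker_conj_envTrace y.sqrt (of (fun i => (w i).ofLp) * V.1ᵀ)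
  rw [conjTranspose_kronecker, y.sqrt_posSemidef.isHermitian.eq, conjTranspose_one] at h
  rw [combine_val, Equiv.apply_symm_apply, randomChoi_val, Matrix.mul_smul, Matrix.smul_mul, smul_smul,
    mul_inv_cancel₀ hd, one_smul, h, Matrix.mul_assoc]

theorem marginal_combine (y : State a) (Λ : Channel a b) : (combine y Λ).marginal = y := by
  have hd : (Fintype.card a : ℂ) ≠ 0 := by simp
  have h : ptrRight (choiEquiv a b Λ).1.1 = (Fintype.card a : ℂ)⁻¹ • (1 : Matrix a a ℂ) :=
    (choiEquiv a b Λ).2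
  have hs : ∀ (c : ℂ) (N : Matrix (a × b) (a × b) ℂ), ptrRight (c • N) = c • ptrRight N := by
    intro c N; ext i j; simp [ptrRight, Finset.mul_sum]
  refine Subtype.ext ?_
  change ptrRight (combine y Λ).1 = y.1
  rw [combine_val, hs, ptrRight_kronecker_conj, h, Matrix.mul_smul, Matrix.smul_mul, smul_smul,
    mul_inv_cancel₀ hd, one_smul, mul_one, y.sqrt_mul_sqrt]

instance instIsProbabilityMeasureChannelMeasure (v : a → EuclideanSpace ℂ (b × (a × b)))
    (hv : Orthonormal ℂ v) : IsProbabilityMeasure (channelMeasure v hv) := by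
  have : IsProbabilityMeasure (choiMeasure v hv) :=
    Measure.isProbabilityMeasure_map (continuous_randomChoi v hv).measurable.aemeasurable
  exact Measure.isProbabilityMeasure_map measurable_choiEquiv_symm.aemeasurable

variable (ψ₀ : EuclideanSpace ℂ ((a × b) × (a × b))) (hψ₀ : ‖ψ₀‖ = 1)
  (v : a → EuclideanSpace ℂ (b × (a × b))) (hv : Orthonormal ℂ v)

theorem stateMeasure_eq_map : stateMeasure ψ₀ hψ₀ =
    (haarUnitary ((a × b) × (a × b))).map fun U => ((pureState ψ₀ hψ₀).conj U).marginal :=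
  Measure.map_map measurable_marginal (continuous_conj_pureState ψ₀ hψ₀).measurable

theorem marginalMeasure_eq_map : marginalMeasure ψ₀ hψ₀ =
    (haarUnitary ((a × b) × (a × b))).map fun U =>
      ((pureState ψ₀ hψ₀).conj U).marginal.marginal := by
  rw [marginalMeasure, stateMeasure_eq_map]
  exact Measure.map_map measurable_marginal
    (measurable_marginal.comp (continuous_conj_pureState ψ₀ hψ₀).measurable)

instance instIsProbabilityMeasureStateMeasure : IsProbabilityMeasure (stateMeasure ψ₀ hψ₀) := by
  rw [stateMeasure_eq_map]
  exact Measure.isProbabilityMeasure_map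
    (measurable_marginal.comp (continuous_conj_pureState ψ₀ hψ₀).measurable).aemeasurable

instance instIsProbabilityMeasureMarginalMeasure :
    IsProbabilityMeasure (marginalMeasure ψ₀ hψ₀) :=
  Measure.isProbabilityMeasure_map measurable_marginal.aemeasurable

theorem map_transpose_marginalMeasure :
    (marginalMeasure ψ₀ hψ₀).map State.transpose = marginalMeasure ψ₀ hψ₀ := by
  have h : (State.transpose ∘ State.marginal ∘ State.marginal :
      State ((a × b) × (a × b)) → State a) =
      (State.marginal ∘ State.marginal) ∘ State.transpose := rfl
  have hm : Measurable (State.marginal ∘ State.marginal :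
      State ((a × b) × (a × b)) → State a) := measurable_marginal.comp measurable_marginal
  rw [marginalMeasure, stateMeasure, Measure.map_map measurable_marginal measurable_marginal,
    Measure.map_map measurable_transpose hm, h, ← Measure.map_map hm measurable_transpose,
    map_transpose_pureMeasure]

theorem ae_fullRank_marginalMeasure : ∀ᵐ y ∂(marginalMeasure ψ₀ hψ₀), y.FullRank := by
  -- `b` is nonempty because `ψ₀` is a unit vector, so `a` embeds into `b × (a × b)`.
  obtain ⟨x⟩ : Nonempty b := by
    by_contra h
    rw [not_nonempty_iff] at h
    rw [Subsingleton.elim ψ₀ 0, norm_zero] at hψ₀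
    exact zero_ne_one hψ₀
  have hf : Function.Injective fun i : a => (x, (i, x)) := fun i j hij => by simpa using hij
  have hm : Measurable fun U => ((pureState ψ₀ hψ₀).conj U).marginal.marginal :=
    measurable_marginal.comp (measurable_marginal.comp
      (continuous_conj_pureState ψ₀ hψ₀).measurable)
  rw [marginalMeasure_eq_map, ae_map_iff hm.aemeasurable measurableSet_fullRank]
  exact ae_fullRank_marginal ⟨_, hf⟩ ψ₀ hψ₀

/-- Applying a Haar-random unitary on the complement of `A` to a pure state whose marginal `y` on
`A` has full rank, and tracing out `A'B'`, gives the state `d_A y^{1/2} J(Λ) y^{1/2}` with `Λ`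
distributed according to the channel measure. -/
theorem lintegral_envUnitary {y : State a} (hy : y.FullRank)
    (U : unitaryGroup ((a × b) × (a × b)) ℂ)
    (hU : ((pureState ψ₀ hψ₀).conj U).marginal.marginal = y)
    {g : State (a × b) → ℝ≥0∞} (hg : Measurable g) :
    ∫⁻ V, g ((pureState ψ₀ hψ₀).conj (envUnitary a V * U)).marginal
        ∂(haarUnitary (b × (a × b))) =
      ∫⁻ Λ, g (combine y Λ) ∂(channelMeasure v hv) := by
  have hM : coeffMatrix (U.1 *ᵥ ψ₀.ofLp) * (coeffMatrix (U.1 *ᵥ ψ₀.ofLp))ᴴ = y.1 := by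
    rw [← ptrRight_envTrace, ← marginal_conj_pureState_val ψ₀ hψ₀, ← hU]
    rfl
  obtain ⟨w, hw, hwM⟩ := exists_orthonormal_sqrt_mul hy hM
  have hgc : Measurable fun Λ : Channel a b => g (combine y Λ) :=
    hg.comp (measurable_combine_left y)
  have hgc' : Measurable fun C : ChoiState a b => g (combine y ((choiEquiv a b).symm C)) :=
    hgc.comp measurable_choiEquiv_symm
  rw [channelMeasure_eq v w hv hw, channelMeasure, choiMeasure,
    lintegral_map hgc measurable_choiEquiv_symm,
    lintegral_map hgc' (continuous_randomChoi w hw).measurable]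
  refine lintegral_congr fun V => congrArg g (Subtype.ext ?_)
  rw [combine_randomChoi_val, hwM, marginal_conj_pureState_val, ← coeffMatrix_envUnitary_mulVec,
    mulVec_mulVec]
  rfl

theorem lintegral_stateMeasure {g : State (a × b) → ℝ≥0∞} (hg : Measurable g) :
    ∫⁻ σ, g σ ∂(stateMeasure ψ₀ hψ₀) =
      ∫⁻ y, ∫⁻ Λ, g (combine y Λ) ∂(channelMeasure v hv) ∂(marginalMeasure ψ₀ hψ₀) := by
  have hF : Continuous fun U => ((pureState ψ₀ hψ₀).conj U).marginal :=
    continuous_marginal.comp (continuous_conj_pureState ψ₀ hψ₀)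
  have hF' : Measurable fun U => ((pureState ψ₀ hψ₀).conj U).marginal.marginal :=
    measurable_marginal.comp hF.measurable
  have hG : Measurable fun y => ∫⁻ Λ, g (combine y Λ) ∂(channelMeasure v hv) :=
    Measurable.lintegral_prod_right' (f := fun p : State a × Channel a b => g (combine p.1 p.2))
      (hg.comp measurable_combine)
  have hVU : Continuous fun q : unitaryGroup (b × (a × b)) ℂ ×
      unitaryGroup ((a × b) × (a × b)) ℂ => envUnitary a q.1 * q.2 :=
    (continuous_envUnitary.comp continuous_fst).mul continuous_snd
  have hae : ∀ᵐ U ∂(haarUnitary ((a × b) × (a × b))),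
      ((pureState ψ₀ hψ₀).conj U).marginal.marginal.FullRank := by
    have h := ae_fullRank_marginalMeasure ψ₀ hψ₀
    rw [marginalMeasure_eq_map] at h
    exact ae_of_ae_map hF'.aemeasurable h
  rw [stateMeasure_eq_map, marginalMeasure_eq_map, lintegral_map hg hF.measurable,
    lintegral_map hG hF']
  calc ∫⁻ U, g ((pureState ψ₀ hψ₀).conj U).marginal ∂(haarUnitary ((a × b) × (a × b)))
      = ∫⁻ V, ∫⁻ U, g ((pureState ψ₀ hψ₀).conj (envUnitary a V * U)).marginal
          ∂(haarUnitary ((a × b) × (a × b))) ∂(haarUnitary (b × (a × b))) := by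
        -- Left invariance of Haar measure makes the outer integrand constant in `V`.
        have h : ∀ V, ∫⁻ U, g ((pureState ψ₀ hψ₀).conj (envUnitary a V * U)).marginal
            ∂(haarUnitary ((a × b) × (a × b))) =
            ∫⁻ U, g ((pureState ψ₀ hψ₀).conj U).marginal ∂(haarUnitary ((a × b) × (a × b))) :=
          fun V => lintegral_mul_left_eq_self
            (fun U => g ((pureState ψ₀ hψ₀).conj U).marginal) (envUnitary a V)
        simp only [h, lintegral_const, measure_univ, mul_one]
    _ = ∫⁻ U, ∫⁻ V, g ((pureState ψ₀ hψ₀).conj (envUnitary a V * U)).marginal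
          ∂(haarUnitary (b × (a × b))) ∂(haarUnitary ((a × b) × (a × b))) :=
        lintegral_lintegral_swap (hg.comp (hF.comp hVU).measurable).aemeasurable
    _ = _ := by
        refine lintegral_congr_ae ?_
        filter_upwards [hae] with U hU
        exact lintegral_envUnitary ψ₀ hψ₀ v hv hU U rfl hg

/-- The state `d_A y^{1/2} J(Λ) y^{1/2}` built from independent `y ∼ dσ_A` and `Λ ∼ dν` has
law `dσ_AB`. -/
theorem measurePreserving_combine :
    MeasurePreserving (fun p : State a × Channel a b => combine p.1 p.2)
      ((marginalMeasure ψ₀ hψ₀).prod (channelMeasure v hv)) (stateMeasure ψ₀ hψ₀) := by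
  refine ⟨measurable_combine, Measure.ext_of_lintegral _ fun g hg => ?_⟩
  rw [lintegral_map hg measurable_combine, lintegral_stateMeasure ψ₀ hψ₀ v hv hg]
  exact lintegral_prod _ (hg.comp measurable_combine).aemeasurable

theorem measurePreserving_combine_transpose :
    MeasurePreserving (fun p : State a × Channel a b => combine p.1.transpose p.2)
      ((marginalMeasure ψ₀ hψ₀).prod (channelMeasure v hv)) (stateMeasure ψ₀ hψ₀) := by
  have ht : MeasurePreserving State.transpose (marginalMeasure ψ₀ hψ₀)
      (marginalMeasure ψ₀ hψ₀) :=
    ⟨measurable_transpose, map_transpose_marginalMeasure ψ₀ hψ₀⟩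
  have h := MeasurePreserving.comp (measurePreserving_combine ψ₀ hψ₀ v hv)
    (ht.prod (MeasurePreserving.id (channelMeasure v hv)))
  exact h

end Factorization

/-! ### Disintegrations along the partial trace -/

section Disintegration

variable {a b : Type*} [Fintype a] [Fintype b] [DecidableEq a] [DecidableEq b]
  {μ : Measure (State (a × b))} [IsProbabilityMeasure μ]
  {κ κ' : Kernel (FullRankState a) (State (a × b))}

theorem measurableEmbedding_fullRank :
    MeasurableEmbedding (Subtype.val : FullRankState a → State a) :=
  MeasurableEmbedding.subtype_coe (s := {y : State a | y.FullRank}) measurableSet_fullRank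

instance instIsFiniteMeasureComapFullRank (m : Measure (State a)) [IsProbabilityMeasure m] :
    IsFiniteMeasure (m.comap (Subtype.val : FullRankState a → State a)) :=
  ⟨by rw [measurableEmbedding_fullRank.comap_apply]; exact measure_lt_top m _⟩

/-- In a disintegration almost every conditional measure is concentrated on its fibre, because
testing against the constant function `1` shows that no mass is lost by restricting to fibres. -/
theorem IsDisintegration.ae_fibre (h : IsDisintegration μ κ) :
    ∀ᵐ y ∂((μ.map State.marginal).comap Subtype.val), κ y (fibre b y.1)ᶜ = 0 := by
  have := h.1
  have : IsProbabilityMeasure (μ.map (State.marginal : State (a × b) → State a)) :=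
    Measure.isProbabilityMeasure_map measurable_marginal.aemeasurable
  have h1 := h.2 (fun _ => 1) measurable_const
  simp only [lintegral_const, measure_univ, Measure.restrict_apply_univ, one_mul] at h1
  have h2 := ae_eq_of_ae_le_of_lintegral_le
    (μ := (μ.map State.marginal).comap (Subtype.val : FullRankState a → State a))
    (f := fun y => κ y (fibre b y.1)) (g := fun _ => 1)
    (Filter.Eventually.of_forall fun y => prob_le_one) (by rw [← h1]; exact ENNReal.one_ne_top)
    aemeasurable_const (by
      rw [← h1, lintegral_const, one_mul, measurableEmbedding_fullRank.comap_apply]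
      exact prob_le_one)
  filter_upwards [h2] with y hy
  rwa [prob_compl_eq_zero_iff (measurableSet_fibre y.1)]

/-- On rectangles the joint measure of a disintegration is determined by `μ` alone, because `κ y`
only sees the points whose marginal is `y`. -/
theorem IsDisintegration.compProd_prod (h : IsDisintegration μ κ) {s : Set (FullRankState a)}
    {t : Set (State (a × b))} (hs : MeasurableSet s) (ht : MeasurableSet t) :
    (((μ.map State.marginal).comap Subtype.val) ⊗ₘ κ) (s ×ˢ t) =
      μ (State.marginal ⁻¹' (Subtype.val '' s) ∩ t) := by
  have := h.1
  have : IsProbabilityMeasure (μ.map (State.marginal : State (a × b) → State a)) :=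
    Measure.isProbabilityMeasure_map measurable_marginal.aemeasurable
  have hT : MeasurableSet (State.marginal ⁻¹' (Subtype.val '' s) ∩ t : Set (State (a × b))) :=
    (measurable_marginal (measurableEmbedding_fullRank.measurableSet_image.mpr hs)).inter ht
  rw [Measure.compProd_apply_prod hs ht, ← lintegral_indicator_one hT,
    h.2 _ (measurable_one.indicator hT), ← lintegral_indicator hs]
  refine lintegral_congr_ae ?_
  filter_upwards [h.ae_fibre] with y hy
  rw [lintegral_indicator_one hT, Measure.restrict_apply hT]
  by_cases hys : y ∈ s
  · rw [Set.indicator_of_mem hys]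
    refine measure_congr ?_
    filter_upwards [mem_ae_iff.mpr hy] with σ hσ
    have hσ' : σ.marginal = y.1 := hσ
    refine propext ⟨fun h => ⟨⟨⟨y, hys, hσ'.symm⟩, h⟩, hσ⟩, fun h => h.1.2⟩
  · rw [Set.indicator_of_notMem hys]
    refine (measure_mono_null (t := ∅) ?_ measure_empty).symm
    rintro σ ⟨⟨⟨z, hz, hzσ⟩, -⟩, hσ⟩
    have hσ' : σ.marginal = y.1 := hσ
    exact hys (Subtype.ext (hzσ.trans hσ') ▸ hz)

theorem IsDisintegration.ae_eq (h : IsDisintegration μ κ) (h' : IsDisintegration μ κ') :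
    ∀ᵐ y ∂((μ.map State.marginal).comap Subtype.val), κ' y = κ y := by
  have := h.1
  have := h'.1
  have : IsProbabilityMeasure (μ.map (State.marginal : State (a × b) → State a)) :=
    Measure.isProbabilityMeasure_map measurable_marginal.aemeasurable
  refine Kernel.ae_eq_of_compProd_eq (Measure.ext_prod fun {s t} hs ht => ?_)
  rw [h.compProd_prod hs ht, h'.compProd_prod hs ht]

end Disintegration

/-! ### The conditional measures -/

section Conditional

variable {a b : Type*} [Fintype a] [Fintype b] [DecidableEq a] [DecidableEq b] [Nonempty a]

theorem combine_fibreToChannel (y : FullRankState a) (σ : fibre b y.1) :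
    combine y.1 (fibreToChannel y σ) = σ.1 := by
  have hd : (Fintype.card a : ℂ) ≠ 0 := by simp
  have hu := (isUnit_iff_isUnit_det _).mp y.2.isUnit_sqrt
  have h1 : (y.1.sqrt ⊗ₖ (1 : Matrix b b ℂ)) * (y.1.sqrt⁻¹ ⊗ₖ (1 : Matrix b b ℂ)) = 1 := by
    rw [← mul_kronecker_mul, mul_nonsing_inv _ hu, one_mul, one_kronecker_one]
  have h2 : (y.1.sqrt⁻¹ ⊗ₖ (1 : Matrix b b ℂ)) * (y.1.sqrt ⊗ₖ (1 : Matrix b b ℂ)) = 1 := by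
    rw [← mul_kronecker_mul, nonsing_inv_mul _ hu, one_mul, one_kronecker_one]
  have h3 : (fibreToChoi y σ).1.1 = (Fintype.card a : ℂ)⁻¹ •
      ((y.1.sqrt⁻¹ ⊗ₖ (1 : Matrix b b ℂ)) * σ.1.1 * (y.1.sqrt⁻¹ ⊗ₖ (1 : Matrix b b ℂ))) := rfl
  refine Subtype.ext ?_
  rw [combine_val, fibreToChannel, Equiv.apply_symm_apply, h3, Matrix.mul_smul, Matrix.smul_mul,
    smul_smul, mul_inv_cancel₀ hd, one_smul, mul_assoc _ σ.1.1, ← mul_assoc _ _ (σ.1.1 * _), h1,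
    one_mul, mul_assoc, h2, mul_one]

theorem combine_injective (y : FullRankState a) :
    Function.Injective (combine y.1 : Channel a b → State (a × b)) := by
  have hd : (Fintype.card a : ℂ) ≠ 0 := by simp
  have hu := (isUnit_iff_isUnit_det _).mp y.2.isUnit_sqrt
  have h1 : (y.1.sqrt ⊗ₖ (1 : Matrix b b ℂ)) * (y.1.sqrt⁻¹ ⊗ₖ (1 : Matrix b b ℂ)) = 1 := by
    rw [← mul_kronecker_mul, mul_nonsing_inv _ hu, one_mul, one_kronecker_one]
  have hS : IsUnit (y.1.sqrt ⊗ₖ (1 : Matrix b b ℂ)) := IsUnit.of_mul_eq_one _ h1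
  intro Λ Λ' h
  refine (choiEquiv a b).injective (Subtype.ext (Subtype.ext ?_))
  have h' := congrArg Subtype.val h
  rw [combine_val, combine_val] at h'
  exact hS.mul_left_cancel (hS.mul_right_cancel (smul_right_injective _ hd h'))

/-- The Borel isomorphism `σ ↦ J⁻¹(d_A⁻¹ y^{-1/2} σ y^{-1/2})` from the fibre over a full-rank
state `y` to the space of channels, with inverse `Λ ↦ d_A y^{1/2} J(Λ) y^{1/2}`. -/
noncomputable def fibreEquiv (b : Type*) [Fintype b] [DecidableEq b] (y : FullRankState a) :
    fibre b y.1 ≃ᵐ Channel a b where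
  toFun := fibreToChannel y
  invFun Λ := ⟨combine y.1 Λ, marginal_combine y.1 Λ⟩
  left_inv σ := Subtype.ext (combine_fibreToChannel y σ)
  right_inv _ := combine_injective y (combine_fibreToChannel y _)
  measurable_toFun := measurable_fibreToChannel y
  measurable_invFun := (measurable_combine_left y.1).subtype_mk

theorem measurableEmbedding_combine (y : FullRankState a) :
    MeasurableEmbedding (combine y.1 : Channel a b → State (a × b)) := by
  have h := (MeasurableEmbedding.subtype_coe (measurableSet_fibre (b := b) y.1)).comp
    (fibreEquiv b y).symm.measurableEmbedding
  exact h

/-- The kernel sending a full-rank state `y` to the law of `d_A y^{1/2} J(Λ) y^{1/2}`, where `Λ`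
has law `ν`. -/
noncomputable def combineKernel (ν : Measure (Channel a b)) [SFinite ν] :
    Kernel (FullRankState a) (State (a × b)) where
  toFun y := ν.map (combine y.1)
  measurable' := by
    refine Measure.measurable_of_measurable_coe _ fun s hs => ?_
    have h : Measurable fun y : State a => ν (Prod.mk y ⁻¹' {p | combine p.1 p.2 ∈ s}) :=
      measurable_measure_prodMk_left (measurable_combine hs)
    have h' : (fun y : FullRankState a => ν.map (combine y.1) s) =
        fun y => ν (Prod.mk y.1 ⁻¹' {p | combine p.1 p.2 ∈ s}) :=
      funext fun y => Measure.map_apply (measurable_combine_left y.1) hs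
    rw [h']
    have h'' := h.comp (measurable_subtype_coe (p := fun y : State a => y.FullRank))
    exact h''

theorem combineKernel_apply (ν : Measure (Channel a b)) [SFinite ν] (y : FullRankState a) :
    combineKernel ν y = ν.map (combine y.1) := rfl

variable (ν : Measure (Channel a b)) [IsProbabilityMeasure ν]

theorem combineKernel_compl_fibre (y : FullRankState a) :
    combineKernel ν y (fibre b y.1)ᶜ = 0 := by
  rw [combineKernel_apply, Measure.map_apply (measurable_combine_left y.1)
    (measurableSet_fibre y.1).compl]
  have : (combine y.1 : Channel a b → State (a × b)) ⁻¹' (fibre b y.1)ᶜ = ∅ :=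
    Set.eq_empty_of_forall_notMem fun Λ hΛ => hΛ (marginal_combine y.1 Λ)
  rw [this, measure_empty]

theorem restrict_combineKernel_fibre (y : FullRankState a) :
    (combineKernel ν y).restrict (fibre b y.1) = combineKernel ν y :=
  Measure.restrict_eq_self_of_ae_mem (mem_ae_iff.mpr (combineKernel_compl_fibre ν y))

theorem measurePreserving_fibreEquiv (y : FullRankState a) :
    MeasurePreserving (fibreEquiv b y) ((combineKernel ν y).comap Subtype.val) ν := by
  have h : MeasurePreserving (fibreEquiv b y).symm ν ((combineKernel ν y).comap Subtype.val) := by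
    refine ⟨(fibreEquiv b y).symm.measurable, ?_⟩
    have h1 : combineKernel ν y = (ν.map (fibreEquiv b y).symm).map Subtype.val :=
      (Measure.map_map measurable_subtype_coe (fibreEquiv b y).symm.measurable).symm
    rw [h1, (MeasurableEmbedding.subtype_coe (measurableSet_fibre y.1)).comap_map]
  exact h.symm

end Conditional

/-! ### Iterated integrals over an image of a product measure -/

section Integrals

variable {X Y Z : Type*} [MeasurableSpace X] [MeasurableSpace Y] [MeasurableSpace Z]
  {μ : Measure X} {ν : Measure Y} {ρ : Measure Z} [SFinite μ] [SFinite ν]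

theorem lintegral_of_measurePreserving_prod {f : X → Y → Z}
    (hf : MeasurePreserving (fun p : X × Y => f p.1 p.2) (μ.prod ν) ρ) {g : Z → ℝ≥0∞}
    (hg : Measurable g) : ∫⁻ z, g z ∂ρ = ∫⁻ x, ∫⁻ y, g (f x y) ∂ν ∂μ := by
  rw [← hf.lintegral_comp hg]
  exact lintegral_prod _ (hg.comp hf.measurable).aemeasurable

theorem integral_of_measurePreserving_prod {f : X → Y → Z}
    (hf : MeasurePreserving (fun p : X × Y => f p.1 p.2) (μ.prod ν) ρ) {g : Z → ℂ}
    (hg : Integrable g ρ) :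
    (∀ᵐ x ∂μ, Integrable (fun y => g (f x y)) ν) ∧
      Integrable (fun x => ∫ y, g (f x y) ∂ν) μ ∧
      ∫ z, g z ∂ρ = ∫ x, ∫ y, g (f x y) ∂ν ∂μ := by
  have h : Integrable (fun p : X × Y => g (f p.1 p.2)) (μ.prod ν) :=
    hf.integrable_comp_of_integrable hg
  refine ⟨h.prod_right_ae, h.integral_prod_left, ?_⟩
  rw [← integral_prod _ h, ← hf.map_eq]
  exact integral_map hf.measurable.aemeasurable (hf.map_eq.symm ▸ hg.aestronglyMeasurable)

end Integrals

/-! ### Integrals against the Haar-induced measure on states -/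

section StateIntegrals

variable {a b : Type*} [Fintype a] [Fintype b] [DecidableEq a] [DecidableEq b] [Nonempty a]
  (ψ₀ : EuclideanSpace ℂ ((a × b) × (a × b))) (hψ₀ : ‖ψ₀‖ = 1)
  (v : a → EuclideanSpace ℂ (b × (a × b))) (hv : Orthonormal ℂ v)

theorem lintegral_stateMeasure_transpose {g : State (a × b) → ℝ≥0∞} (hg : Measurable g) :
    ∫⁻ σ, g σ ∂(stateMeasure ψ₀ hψ₀) =
      ∫⁻ y, ∫⁻ Λ, g (combine y.transpose Λ) ∂(channelMeasure v hv)
        ∂(marginalMeasure ψ₀ hψ₀) := by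
  have h := lintegral_of_measurePreserving_prod (f := fun y Λ => combine (State.transpose y) Λ)
    (measurePreserving_combine_transpose ψ₀ hψ₀ v hv) hg
  exact h

theorem integral_stateMeasure {g : State (a × b) → ℂ}
    (hg : Integrable g (stateMeasure ψ₀ hψ₀)) :
    (∀ᵐ y ∂(marginalMeasure ψ₀ hψ₀),
        Integrable (fun Λ => g (combine y Λ)) (channelMeasure v hv)) ∧
      Integrable (fun y => ∫ Λ, g (combine y Λ) ∂(channelMeasure v hv))
        (marginalMeasure ψ₀ hψ₀) ∧
      ∫ σ, g σ ∂(stateMeasure ψ₀ hψ₀) =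
        ∫ y, ∫ Λ, g (combine y Λ) ∂(channelMeasure v hv) ∂(marginalMeasure ψ₀ hψ₀) := by
  have h := integral_of_measurePreserving_prod (f := fun y Λ => combine y Λ)
    (measurePreserving_combine ψ₀ hψ₀ v hv) hg
  exact h

theorem integral_stateMeasure_transpose {g : State (a × b) → ℂ}
    (hg : Integrable g (stateMeasure ψ₀ hψ₀)) :
    (∀ᵐ y ∂(marginalMeasure ψ₀ hψ₀),
        Integrable (fun Λ => g (combine y.transpose Λ)) (channelMeasure v hv)) ∧
      Integrable (fun y => ∫ Λ, g (combine y.transpose Λ) ∂(channelMeasure v hv))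
        (marginalMeasure ψ₀ hψ₀) ∧
      ∫ σ, g σ ∂(stateMeasure ψ₀ hψ₀) =
        ∫ y, ∫ Λ, g (combine y.transpose Λ) ∂(channelMeasure v hv)
          ∂(marginalMeasure ψ₀ hψ₀) := by
  have h := integral_of_measurePreserving_prod (f := fun y Λ => combine (State.transpose y) Λ)
    (measurePreserving_combine_transpose ψ₀ hψ₀ v hv) hg
  exact h

theorem restrict_marginalMeasure_fullRank :
    (marginalMeasure ψ₀ hψ₀).restrict {y | y.FullRank} = marginalMeasure ψ₀ hψ₀ :=
  Measure.restrict_eq_self_of_ae_mem (ae_fullRank_marginalMeasure ψ₀ hψ₀)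

theorem isDisintegration_combineKernel :
    IsDisintegration (stateMeasure ψ₀ hψ₀) (combineKernel (channelMeasure v hv)) := by
  refine ⟨⟨fun y => Measure.isProbabilityMeasure_map
    (measurable_combine_left y.1).aemeasurable⟩, fun g hg => ?_⟩
  have h1 : ∀ y : FullRankState a,
      ∫⁻ σ in fibre b y.1, g σ ∂(combineKernel (channelMeasure v hv) y) =
        ∫⁻ Λ, g (combine y.1 Λ) ∂(channelMeasure v hv) := fun y => by
    rw [restrict_combineKernel_fibre, combineKernel_apply,
      lintegral_map hg (measurable_combine_left y.1)]
  simp only [h1]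
  rw [lintegral_stateMeasure ψ₀ hψ₀ v hv hg]
  conv_lhs => rw [← restrict_marginalMeasure_fullRank]
  exact (lintegral_subtype_comap measurableSet_fullRank
    fun y => ∫⁻ Λ, g (combine y Λ) ∂(channelMeasure v hv)).symm

theorem integral_combineKernel {g : State (a × b) → ℂ}
    (hg : Integrable g (stateMeasure ψ₀ hψ₀)) :
    ∫ σ, g σ ∂(stateMeasure ψ₀ hψ₀) =
      ∫ y : FullRankState a, ∫ σ in fibre b y.1, g σ ∂(combineKernel (channelMeasure v hv) y)
        ∂((marginalMeasure ψ₀ hψ₀).comap Subtype.val) := by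
  have h1 : ∀ y : FullRankState a,
      ∫ σ in fibre b y.1, g σ ∂(combineKernel (channelMeasure v hv) y) =
        ∫ Λ, g (combine y.1 Λ) ∂(channelMeasure v hv) := fun y => by
    rw [restrict_combineKernel_fibre, combineKernel_apply,
      (measurableEmbedding_combine y).integral_map]
  simp only [h1]
  rw [(integral_stateMeasure ψ₀ hψ₀ v hv hg).2.2]
  conv_lhs => rw [← restrict_marginalMeasure_fullRank]
  exact (integral_subtype_comap measurableSet_fullRank
    fun y => ∫ Λ, g (combine y Λ) ∂(channelMeasure v hv)).symm

end StateIntegrals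

end ChannelMeasures

theorem mainTheorem7 {a b : Type*} [Fintype a] [Fintype b] [DecidableEq a] [DecidableEq b]
    [Nonempty a]
    (ψ₀ : EuclideanSpace ℂ ((a × b) × (a × b))) (hψ₀ : ‖ψ₀‖ = 1)
    (v : a → EuclideanSpace ℂ (b × (a × b))) (hv : Orthonormal ℂ v) :
    -- rank-deficient marginals are negligible
    marginalMeasure ψ₀ hψ₀ {y | ¬ y.FullRank} = 0 ∧
    -- essentially unique disintegration, each conditional measure being isomorphic to `ν`
    (∃ κ : Kernel (FullRankState a) (State (a × b)),
      IsDisintegration (stateMeasure ψ₀ hψ₀) κ ∧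
      (∀ g : State (a × b) → ℂ, Integrable g (stateMeasure ψ₀ hψ₀) →
        ∫ σ, g σ ∂(stateMeasure ψ₀ hψ₀) =
          ∫ y : FullRankState a, ∫ σ in fibre b y.1, g σ ∂(κ y)
            ∂((marginalMeasure ψ₀ hψ₀).comap Subtype.val)) ∧
      (∀ κ' : Kernel (FullRankState a) (State (a × b)),
        IsDisintegration (stateMeasure ψ₀ hψ₀) κ' →
        ∀ᵐ y ∂((marginalMeasure ψ₀ hψ₀).comap Subtype.val), κ' y = κ y) ∧
      ∀ y : FullRankState a,
        κ y (fibre b y.1)ᶜ = 0 ∧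
        ∃ e : fibre b y.1 ≃ᵐ Channel a b,
          (∀ σ, e σ = fibreToChannel y σ) ∧
          (∀ Λ, (e.symm Λ : State (a × b)) = combine y.1 Λ) ∧
          MeasurePreserving e ((κ y).comap Subtype.val) (channelMeasure v hv)) ∧
    -- the factorization formulas, for nonnegative measurable functions
    (∀ g : State (a × b) → ℝ≥0∞, Measurable g →
      ∫⁻ σ, g σ ∂(stateMeasure ψ₀ hψ₀) =
          ∫⁻ y, ∫⁻ Λ, g (combine y Λ) ∂(channelMeasure v hv) ∂(marginalMeasure ψ₀ hψ₀) ∧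
      ∫⁻ σ, g σ ∂(stateMeasure ψ₀ hψ₀) =
          ∫⁻ y, ∫⁻ Λ, g (combine y.transpose Λ) ∂(channelMeasure v hv)
            ∂(marginalMeasure ψ₀ hψ₀)) ∧
    -- and for integrable functions
    (∀ g : State (a × b) → ℂ, Integrable g (stateMeasure ψ₀ hψ₀) →
      ((∀ᵐ y ∂(marginalMeasure ψ₀ hψ₀),
          Integrable (fun Λ => g (combine y Λ)) (channelMeasure v hv)) ∧
        Integrable (fun y => ∫ Λ, g (combine y Λ) ∂(channelMeasure v hv))
          (marginalMeasure ψ₀ hψ₀) ∧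
        ∫ σ, g σ ∂(stateMeasure ψ₀ hψ₀) =
          ∫ y, ∫ Λ, g (combine y Λ) ∂(channelMeasure v hv) ∂(marginalMeasure ψ₀ hψ₀)) ∧
      ((∀ᵐ y ∂(marginalMeasure ψ₀ hψ₀),
          Integrable (fun Λ => g (combine y.transpose Λ)) (channelMeasure v hv)) ∧
        Integrable (fun y => ∫ Λ, g (combine y.transpose Λ) ∂(channelMeasure v hv))
          (marginalMeasure ψ₀ hψ₀) ∧
        ∫ σ, g σ ∂(stateMeasure ψ₀ hψ₀) =
          ∫ y, ∫ Λ, g (combine y.transpose Λ) ∂(channelMeasure v hv)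
            ∂(marginalMeasure ψ₀ hψ₀))) := by
  refine ⟨ae_iff.mp (ae_fullRank_marginalMeasure ψ₀ hψ₀),
    ⟨combineKernel (channelMeasure v hv), isDisintegration_combineKernel ψ₀ hψ₀ v hv,
      fun g hg => integral_combineKernel ψ₀ hψ₀ v hv hg,
      fun κ' h' => (isDisintegration_combineKernel ψ₀ hψ₀ v hv).ae_eq h',
      fun y => ⟨combineKernel_compl_fibre _ y, fibreEquiv b y, fun _ => rfl, fun _ => rfl,
        measurePreserving_fibreEquiv _ y⟩⟩,
    fun g hg => ⟨lintegral_stateMeasure ψ₀ hψ₀ v hv hg,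
      lintegral_stateMeasure_transpose ψ₀ hψ₀ v hv hg⟩,
    fun g hg => ⟨integral_stateMeasure ψ₀ hψ₀ v hv hg,
      integral_stateMeasure_transpose ψ₀ hψ₀ v hv hg⟩⟩
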